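/- Let $L>0$ and $\mu>0$. For small $\gamma>0$ put $L_\gamma=\frac{2}{\gamma}\Big(\sqrt{1+\tfrac{\gamma L}{2}}-\sqrt{1-\tfrac{\gamma L}{2}}\Big)$ and $$\delta(x)=-\frac{3L_\gamma}{4L}\,\frac{\gamma}{\sqrt{1+\frac{\gamma L}{2}}-\frac{\gamma L_\gamma x}{2L}}\quad(x\in[0,L]),\qquad \Lambda=\begin{pmatrix}1&0\\0&-1\end{pmatrix},\qquad J=\begin{pmatrix}0&\frac13\\-\frac13&0\end{pmatrix}.$$ Consider the target system with boundary damping, for $z=(z_1,z_2)$ with values in $\mathbb{C}^2$, $$\partial_t z+\Lambda\partial_x z+\delta(x)Jz=0,\qquad z_1(t,0)=-e^{-2\mu L}z_2(t,0),\qquad z_2(t,L)=-z_1(t,L),\qquad t\ge 0,\ x\in(0,L).\tag{1}$$ For $p\in\mathbb{N}=\{0,1,2,\dots\}$, a function $z_0\in H^p((0,L);\mathbb{C}^2)$ is called compatible if $z_0,\widetilde{\mathcal A}z_0,\dots,\widetilde{\mathcal A}^{p-1}z_0$ satisfy the boundary conditions in (1), where $\widetilde{\mathcal A}=\Lambda\partial_x+\delta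 J$ (no condition if $p=0$). We say that (1) is exponentially stable in $H^p$ with decay rate $\lambda$ if there is a constant $C>0$ such that for every compatible $z_0\in H^p((0,L);\mathbb{C}^2)$ the system (1) has a unique solution $z\in C^0([0,+\infty);H^p((0,L);\mathbb{C}^2))$ with $z(0,\cdot)=z_0$, and $$\|z(t,\cdot)\|_{H^p}\le Ce^{-\lambda t}\|z_0\|_{H^p}\qquad\text{for all }t\ge 0.$$ Here solutions are understood in the weak sense (tested against $C^1$ functions on $[0,L]$ satisfying the adjoint boundary conditions); for $p\ge1$ the solution moreover satisfies the boundary conditions in the sense of traces and the equation in $L^2$ for every $t\ge 0$. **Proposition.** There is a continuous, decreasing function $\gamma_s:(0,\mu)\to(0,+\infty)$ such that for every $\lambda_0\in(0,\mu)$, every $\gamma\in(0,\gamma_s(\lambda_0))$, every $\lambda\in[0,\lambda_0]$ and every $p\in\mathbb{N}$, the system (1) is exponentially stable in $H^p$ with decay rate $\lambda$. -/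

import Mathlib

open MeasureTheory Set
open scoped ContDiff

noncomputable section

namespace WaterTank

/-- `L²((0,L); ℂ²)`. -/
abbrev L2 (L : ℝ) : Type :=
  Lp (EuclideanSpace ℂ (Fin 2)) 2 (volume.restrict (Ioo (0 : ℝ) L))

/-- `g` is the weak derivative of `f` on `(0,L)`: for every real test function
`φ ∈ C_c^∞((0,L))`, `∫ φ' f = - ∫ φ g`. -/
def HasWeakDeriv {L : ℝ} (f g : L2 L) : Prop :=
  ∀ φ : ℝ → ℝ, ContDiff ℝ ∞ φ → HasCompactSupport φ → tsupport φ ⊆ Ioo 0 L →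
    ∫ x in Ioo 0 L, deriv φ x • f x = - ∫ x in Ioo 0 L, φ x • g x

theorem integrable_smul_L2 {L : ℝ} {φ : ℝ → ℝ} (hφ : Continuous φ)
    (hc : HasCompactSupport φ) (f : L2 L) :
    Integrable (fun x => φ x • f x) (volume.restrict (Ioo (0 : ℝ) L)) := by
  have hf : Integrable (fun x => f x) (volume.restrict (Ioo (0 : ℝ) L)) :=
    (Lp.memLp f).integrable (by norm_num)
  obtain ⟨C, hC⟩ := hc.exists_bound_of_continuous hφ
  exact hf.bdd_smul C hφ.aestronglyMeasurable (Filter.Eventually.of_forall hC)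

theorem hasWeakDeriv_zero (L : ℝ) : HasWeakDeriv (0 : L2 L) 0 := by
  intro φ _ _ _
  have h0 : ∀ ψ : ℝ → ℝ, ∫ x in Ioo 0 L, ψ x • (0 : L2 L) x = 0 := by
    intro ψ
    rw [integral_eq_zero_of_ae]
    filter_upwards [Lp.coeFn_zero (EuclideanSpace ℂ (Fin 2)) 2
      (volume.restrict (Ioo (0 : ℝ) L))] with x hx
    rw [hx]
    simp
  rw [h0, h0, neg_zero]

theorem HasWeakDeriv.add {L : ℝ} {f g f' g' : L2 L} (hf : HasWeakDeriv f f')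
    (hg : HasWeakDeriv g g') : HasWeakDeriv (f + g) (f' + g') := by
  intro φ hφ hc hs
  have key : ∀ (ψ : ℝ → ℝ), Continuous ψ → HasCompactSupport ψ → ∀ a b : L2 L,
      ∫ x in Ioo 0 L, ψ x • (a + b : L2 L) x
        = (∫ x in Ioo 0 L, ψ x • a x) + (∫ x in Ioo 0 L, ψ x • b x) := by
    intro ψ hψ hψc a b
    rw [← integral_add (integrable_smul_L2 hψ hψc a) (integrable_smul_L2 hψ hψc b)]
    apply integral_congr_ae
    filter_upwards [Lp.coeFn_add a b] with x hx
    rw [hx, Pi.add_apply, smul_add]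
  rw [key _ (hφ.continuous_deriv (by simp)) hc.deriv, key _ hφ.continuous hc,
    hf φ hφ hc hs, hg φ hφ hc hs, neg_add]

theorem HasWeakDeriv.smul {L : ℝ} {f f' : L2 L} (c : ℂ) (hf : HasWeakDeriv f f') :
    HasWeakDeriv (c • f) (c • f') := by
  intro φ hφ hc hs
  have key : ∀ (ψ : ℝ → ℝ) (a : L2 L),
      ∫ x in Ioo 0 L, ψ x • (c • a : L2 L) x = c • ∫ x in Ioo 0 L, ψ x • a x := by
    intro ψ a
    rw [← integral_smul]
    apply integral_congr_ae
    filter_upwards [Lp.coeFn_smul c a] with x hx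
    rw [hx, Pi.smul_apply, smul_comm]
  rw [key, key, hf φ hφ hc hs, smul_neg]

/-- The Sobolev space `H^p((0,L); ℂ²)`. Since weak derivatives are unique, an element is a function
in `L²` recorded together with its successive weak derivatives up to order `p`, all in `L²`. The
norm inherited from the `ℓ²`-product is `(∑_{k ≤ p} ‖∂ₓᵏ f‖²_{L²})^{1/2}`. -/
def sobolev (L : ℝ) (p : ℕ) : Submodule ℂ (PiLp 2 (fun _ : Fin (p + 1) => L2 L)) where
  carrier := {u | ∀ k : Fin p, HasWeakDeriv (u k.castSucc) (u k.succ)}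
  zero_mem' := fun _ => hasWeakDeriv_zero L
  add_mem' := fun ha hb k => (ha k).add (hb k)
  smul_mem' := fun c _ ha k => (ha k).smul c

/-- `H^p((0,L); ℂ²)` as a normed space. -/
abbrev Hp (L : ℝ) (p : ℕ) : Type := sobolev L p

/-- The function in `L²` underlying an element of `H^p`. -/
def Hp.toL2 {L : ℝ} {p : ℕ} (u : Hp L p) : L2 L :=
  (u : PiLp 2 (fun _ : Fin (p + 1) => L2 L)) 0

/-- `L_γ = (2/γ) (√(1 + γL/2) - √(1 - γL/2))`. -/
def Lgam (L γ : ℝ) : ℝ := 2 / γ * (√(1 + γ * L / 2) - √(1 - γ * L / 2))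

/-- The coupling coefficient
`δ(x) = - (3 L_γ / (4 L)) γ / (√(1 + γL/2) - γ L_γ x / (2L))`. -/
def delta (L γ x : ℝ) : ℝ :=
  -(3 * Lgam L γ / (4 * L)) * (γ / (√(1 + γ * L / 2) - γ * Lgam L γ * x / (2 * L)))

/-- `Λ d + δ(x) J u` with `Λ = diag(1,-1)` and `J = ((0, 1/3), (-1/3, 0))`, where `u` stands for the
value at `x` of a function and `d` for the value of its derivative. -/
def diffExpr (L γ x : ℝ) (u d : EuclideanSpace ℂ (Fin 2)) : EuclideanSpace ℂ (Fin 2) :=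
  !₂[d 0 + (delta L γ x : ℂ) * (1 / 3 * u 1), -d 1 + (delta L γ x : ℂ) * (-(1 / 3) * u 0)]

/-- The boundary conditions `f₁(0) = -e^{-2μL} f₂(0)` and `f₂(L) = -f₁(L)`, read on the
continuous representative `u` of `f` on `[0,L]`. -/
def BoundaryCond (L μ : ℝ) (f : L2 L) : Prop :=
  ∃ u : ℝ → EuclideanSpace ℂ (Fin 2), ContinuousOn u (Icc 0 L) ∧
    (f =ᵐ[volume.restrict (Ioo (0 : ℝ) L)] u) ∧
    u 0 0 = -(Real.exp (-2 * μ * L) : ℂ) * u 0 1 ∧ u L 1 = -u L 0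

/-- `f` lies in the domain of `Ã = Λ ∂ₓ + δ J`, i.e. `f ∈ H¹` and `f` satisfies the boundary
conditions, and `g = Ã f`. -/
def TargetOp (L μ γ : ℝ) (f g : L2 L) : Prop :=
  ∃ d : L2 L, HasWeakDeriv f d ∧ BoundaryCond L μ f ∧
    g =ᵐ[volume.restrict (Ioo (0 : ℝ) L)] fun x => diffExpr L γ x (f x) (d x)

/-- Compatibility conditions of order `p`: `f`, `Ã f`, …, `Ã^{p-1} f` are defined and all satisfy
the boundary conditions (no condition if `p = 0`). -/
def Compatible (L μ γ : ℝ) : ℕ → L2 L → Prop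
  | 0, _ => True
  | p + 1, f => ∃ g : L2 L, TargetOp L μ γ f g ∧ Compatible L μ γ p g

/-- `∫₀ᴸ ⟨f(x), ψ(x)⟩ dx`, conjugate-linear in `ψ`. -/
def pairing {L : ℝ} (f : L2 L) (ψ : ℝ → EuclideanSpace ℂ (Fin 2)) : ℂ :=
  ∫ x in Ioo 0 L, inner ℂ (ψ x) (f x)

/-- `z ∈ C⁰([0,∞); H^p)` is a weak solution of
`∂ₜz + Λ ∂ₓz + δ J z = 0`, `z₁(t,0) = -e^{-2μL} z₂(t,0)`, `z₂(t,L) = -z₁(t,L)`, `z(0) = z₀`.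
The test functions are the `C¹` functions on `[0,L]` satisfying the adjoint boundary conditions;
the adjoint of `-(Λ ∂ₓ + δ J)` is the same expression `Λ ∂ₓ + δ J`, as `J` is antisymmetric. -/
structure IsWeakSolution (L μ γ : ℝ) {p : ℕ} (z₀ : Hp L p) (z : ℝ → Hp L p) : Prop where
  continuousOn : ContinuousOn z (Ici 0)
  initial : z 0 = z₀
  weak : ∀ ψ : ℝ → EuclideanSpace ℂ (Fin 2), ContDiff ℝ 1 ψ →
    ψ 0 0 = -(Real.exp (2 * μ * L) : ℂ) * ψ 0 1 → ψ L 1 = -ψ L 0 →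
    ∀ t : ℝ, 0 ≤ t →
      pairing (z t).toL2 ψ = pairing z₀.toL2 ψ
        + ∫ s in (0 : ℝ)..t, pairing (z s).toL2 (fun x => diffExpr L γ x (ψ x) (deriv ψ x))

/-- The strong form: for every `t ≥ 0`, `z(t) ∈ H¹` satisfies the boundary conditions and
`∂ₜz = -(Λ ∂ₓz + δ J z)` in `L²`. -/
def SolvesStrongly (L μ γ : ℝ) {p : ℕ} (z : ℝ → Hp L p) : Prop :=
  ∀ t : ℝ, 0 ≤ t → ∃ g : L2 L, TargetOp L μ γ (z t).toL2 g ∧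
    HasDerivWithinAt (fun s => (z s).toL2) (-g) (Ici 0) t

/-- Exponential stability of the target system for the `H^p` norm with decay rate `lam`: for all
compatible data in `H^p` there is a unique solution in `C⁰([0,∞); H^p)` (which, if `p ≥ 1`,
satisfies the equation and the boundary conditions in the strong sense), and
`‖z(t)‖ ≤ C e^{-lam t} ‖z₀‖` with `C` independent of the data. -/
def ExpStable (L μ γ : ℝ) (p : ℕ) (lam : ℝ) : Prop :=
  ∃ C : ℝ, 0 < C ∧ ∀ z₀ : Hp L p, Compatible L μ γ p z₀.toL2 →
    ∃ z : ℝ → Hp L p, IsWeakSolution L μ γ z₀ z ∧ (1 ≤ p → SolvesStrongly L μ γ z) ∧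
      (∀ y : ℝ → Hp L p, IsWeakSolution L μ γ z₀ y → ∀ t : ℝ, 0 ≤ t → y t = z t) ∧
      ∀ t : ℝ, 0 ≤ t → ‖z t‖ ≤ C * Real.exp (-lam * t) * ‖z₀‖

end WaterTank

end

/-!
The weight `diag(e^{-μx}, -e^{-μ(2L-x)})` turns the boundary conditions into `v₁ = v₂` at both ends
and `Λ∂ₓ` into `μ + Λ∂ₓ`. Unfolding `(0, L)` to the circle `(-L, L)` by reflection, the latter is
`∂ₓ` on a circle: it is diagonal in the orthonormal basis `(e^{iπnx/L}, e^{-iπnx/L}) / √(2L)` of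
`L²`, with eigenvalues `μ + iπn/L`. The coupling `δJ` becomes a bounded perturbation of norm `O(γ)`.
In the interaction picture the perturbed system is a Volterra equation with unitary conjugations of
the perturbation, and Grönwall's inequality gives the decay rate `μ - O(γ)` in `L²`. In `H^p`, the
operator `Ã` commutes with the flow, and `f, Ãf ∈ H^p` control `f` in `H^{p+1}` because
`∂ₓf = Λ(Ãf - δJf)`; the decay therefore propagates from `p` to `p + 1`.
-/

namespace WaterTank

noncomputable section

open scoped InnerProductSpace

local notation "ℂ²" => EuclideanSpace ℂ (Fin 2)

section Volterra

theorem intervalIntegrable_of_continuousOn_Ici {E : Type*} [NormedAddCommGroup E] {F : ℝ → E}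
    {a t : ℝ} (hF : ContinuousOn F (Ici a)) (ht : a ≤ t) : IntervalIntegrable F volume a t :=
  (hF.mono (uIcc_of_le ht ▸ Icc_subset_Ici_self)).intervalIntegrable

variable {K : Type*} [NormedAddCommGroup K] [NormedSpace ℝ K]

theorem exp_neg_mul_integral_exp_le (M t : ℝ) :
    Real.exp (-(2 * M * t)) * ∫ s in (0 : ℝ)..t, M * Real.exp (2 * M * s) ≤ 1 / 2 := by
  have hderiv (s : ℝ) :
      HasDerivAt (fun r => Real.exp (2 * M * r) / 2) (M * Real.exp (2 * M * s)) s := by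
    convert! (((hasDerivAt_id s).const_mul (2 * M)).exp.div_const 2) using 1
    simp only [id_eq]
    ring
  rw [intervalIntegral.integral_eq_sub_of_hasDerivAt (fun s _ => hderiv s)
    (Continuous.intervalIntegrable (by fun_prop) _ _), mul_sub, mul_div_assoc', ← Real.exp_add]
  simp only [neg_add_cancel, Real.exp_zero, mul_zero]
  linarith [Real.exp_pos (-(2 * M * t))]

variable {A : ℝ → K →L[ℝ] K} {M : ℝ}

/-- The Volterra operator `f ↦ ∫₀ᵗ A(s) f(s) ds` conjugated by the weight `e^{2Mt}`, which makes it
a contraction of the bounded functions when `‖A(s)‖ ≤ M`. Replacing `t` by `max t 0` extends the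
result constantly to negative times, so that functions on all of `ℝ` can be used. -/
def weightedVolterra (A : ℝ → K →L[ℝ] K) (M : ℝ) (f : ℝ → K) (t : ℝ) : K :=
  Real.exp (-(2 * M * max t 0)) •
    ∫ s in (0 : ℝ)..max t 0, A s (Real.exp (2 * M * s) • f s)

theorem continuous_weightedVolterra_integrand (hA : Continuous fun q : ℝ × K => A q.1 q.2)
    {f : ℝ → K} (hf : Continuous f) : Continuous fun s => A s (Real.exp (2 * M * s) • f s) :=
  hA.comp (f := fun s => (s, Real.exp (2 * M * s) • f s)) (by fun_prop)

theorem continuous_weightedVolterra (hA : Continuous fun q : ℝ × K => A q.1 q.2) {f : ℝ → K}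
    (hf : Continuous f) : Continuous (weightedVolterra A M f) := by
  have hprim : Continuous fun t => ∫ s in (0 : ℝ)..t, A s (Real.exp (2 * M * s) • f s) :=
    intervalIntegral.continuous_primitive
      (fun _ _ => (continuous_weightedVolterra_integrand hA hf).intervalIntegrable _ _) 0
  have hmax : Continuous fun t : ℝ => max t 0 := by fun_prop
  exact Continuous.smul (by fun_prop) (hprim.comp hmax)

theorem norm_weightedVolterra_le (hM : ∀ s, ‖A s‖ ≤ M) (f : BoundedContinuousFunction ℝ K)
    (t : ℝ) : ‖weightedVolterra A M f t‖ ≤ 1 / 2 * ‖f‖ := by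
  have : 0 ≤ M := (norm_nonneg _).trans (hM 0)
  have hintegrand (s : ℝ) :
      ‖A s (Real.exp (2 * M * s) • f s)‖ ≤ M * Real.exp (2 * M * s) * ‖f‖ := by
    rw [mul_assoc M]
    refine (A s).le_of_opNorm_le_of_le (hM s) ?_
    rw [norm_smul, Real.norm_of_nonneg (Real.exp_pos _).le]
    gcongr
    exact f.norm_coe_le_norm s
  have hintegral : ‖∫ s in (0 : ℝ)..max t 0, A s (Real.exp (2 * M * s) • f s)‖
      ≤ ∫ s in (0 : ℝ)..max t 0, M * Real.exp (2 * M * s) * ‖f‖ :=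
    intervalIntegral.norm_integral_le_of_norm_le (le_max_right t 0)
      (Filter.Eventually.of_forall fun s _ => hintegrand s)
      (Continuous.intervalIntegrable (by fun_prop) _ _)
  rw [intervalIntegral.integral_mul_const] at hintegral
  rw [weightedVolterra, norm_smul, Real.norm_of_nonneg (Real.exp_pos _).le]
  calc _ ≤ Real.exp (-(2 * M * max t 0)) *
        ((∫ s in (0 : ℝ)..max t 0, M * Real.exp (2 * M * s)) * ‖f‖) := by gcongr
    _ ≤ 1 / 2 * ‖f‖ := by
        rw [← mul_assoc]
        gcongr
        exact exp_neg_mul_integral_exp_le M _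

/-- `weightedVolterra` as a bounded operator on the bounded continuous functions. -/
def weightedVolterraCLM (hA : Continuous fun q : ℝ × K => A q.1 q.2) (hM : ∀ s, ‖A s‖ ≤ M) :
    BoundedContinuousFunction ℝ K →L[ℝ] BoundedContinuousFunction ℝ K :=
  LinearMap.mkContinuous
    { toFun f := BoundedContinuousFunction.ofNormedAddCommGroup _
        (continuous_weightedVolterra hA f.continuous) _ (norm_weightedVolterra_le hM f)
      map_add' f g := by
        ext t
        have hint (f : BoundedContinuousFunction ℝ K) :
            IntervalIntegrable (fun s => A s (Real.exp (2 * M * s) • f s)) volume 0 (max t 0) :=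
          (continuous_weightedVolterra_integrand hA f.continuous).intervalIntegrable _ _
        simp only [weightedVolterra, BoundedContinuousFunction.coe_ofNormedAddCommGroup,
          BoundedContinuousFunction.coe_add, Pi.add_apply, smul_add, map_add,
          intervalIntegral.integral_add (hint f) (hint g)]
      map_smul' c f := by
        ext t
        simp only [weightedVolterra, BoundedContinuousFunction.coe_ofNormedAddCommGroup,
          BoundedContinuousFunction.coe_smul, RingHom.id_apply, smul_comm _ c,
          map_smul, intervalIntegral.integral_smul] }
    (1 / 2) fun f => BoundedContinuousFunction.norm_ofNormedAddCommGroup_le _ (by positivity)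
      (norm_weightedVolterra_le hM f)

theorem weightedVolterraCLM_apply (hA : Continuous fun q : ℝ × K => A q.1 q.2)
    (hM : ∀ s, ‖A s‖ ≤ M) (f : BoundedContinuousFunction ℝ K) (t : ℝ) :
    weightedVolterraCLM hA hM f t = weightedVolterra A M f t := rfl

theorem norm_weightedVolterraCLM_lt_one (hA : Continuous fun q : ℝ × K => A q.1 q.2)
    (hM : ∀ s, ‖A s‖ ≤ M) : ‖weightedVolterraCLM hA hM‖ < 1 :=
  (LinearMap.mkContinuous_norm_le _ (by norm_num) _).trans_lt (by norm_num)

theorem exists_eq_add_integral [CompleteSpace K] (hA : Continuous fun q : ℝ × K => A q.1 q.2)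
    (hM : ∀ s, ‖A s‖ ≤ M) (x₀ : K) :
    ∃ v : ℝ → K, Continuous v ∧ ∀ t, 0 ≤ t → v t = x₀ + ∫ s in (0 : ℝ)..t, A s (v s) := by
  have hM0 : 0 ≤ M := (norm_nonneg _).trans (hM 0)
  let g : BoundedContinuousFunction ℝ K := BoundedContinuousFunction.ofNormedAddCommGroup
    (fun t => Real.exp (-(2 * M * max t 0)) • x₀) (by fun_prop) ‖x₀‖ fun t => by
      rw [norm_smul, Real.norm_of_nonneg (Real.exp_pos _).le]
      exact mul_le_of_le_one_left (norm_nonneg _)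
        (Real.exp_le_one_iff.2 (neg_nonpos.2 (by positivity)))
  obtain ⟨f, hf⟩ := (ContinuousLinearMap.isUnit_iff_bijective.1
    (isUnit_one_sub_of_norm_lt_one (norm_weightedVolterraCLM_lt_one hA hM))).2 g
  refine ⟨fun s => Real.exp (2 * M * s) • f s, by fun_prop, fun t ht => ?_⟩
  have hft : f t = g t + weightedVolterra A M f t := by
    rw [← hf, ← weightedVolterraCLM_apply hA hM]
    simp
  have hg : g t = Real.exp (-(2 * M * t)) • x₀ := by simp [g, max_eq_left ht]
  simp only [hft, hg, weightedVolterra, max_eq_left ht]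
  rw [← smul_add, smul_smul, ← Real.exp_add, add_neg_cancel, Real.exp_zero,
    one_smul]

variable {F v : ℝ → K} {x₀ : K} {t : ℝ}

theorem hasDerivWithinAt_of_eq_add_integral [CompleteSpace K] (hF : ContinuousOn F (Ici 0))
    (hv : ∀ t, 0 ≤ t → v t = x₀ + ∫ s in (0 : ℝ)..t, F s) (ht : 0 ≤ t) :
    HasDerivWithinAt v (F t) (Ici 0) t := by
  have hext : Continuous fun s => F (max s 0) :=
    hF.comp_continuous (by fun_prop) fun s => le_max_right s 0
  have hv' (r : ℝ) (hr : 0 ≤ r) : v r = x₀ + ∫ s in (0 : ℝ)..r, F (max s 0) := by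
    rw [hv r hr]
    congr 1
    refine intervalIntegral.integral_congr fun s hs => ?_
    rw [uIcc_of_le hr] at hs
    simp only [max_eq_left hs.1]
  have hderiv := (intervalIntegral.integral_hasDerivAt_right (hext.intervalIntegrable 0 t)
    (hext.stronglyMeasurableAtFilter _ _) hext.continuousAt).const_add x₀
  rw [max_eq_left ht] at hderiv
  exact hderiv.hasDerivWithinAt.congr hv' (hv' t ht)

theorem eq_add_integral_of_hasDerivWithinAt [CompleteSpace K] (hF : ContinuousOn F (Ici 0))
    (hv : ∀ t, 0 ≤ t → HasDerivWithinAt v (F t) (Ici 0) t) (ht : 0 ≤ t) :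
    v t = v 0 + ∫ s in (0 : ℝ)..t, F s := by
  rw [intervalIntegral.integral_eq_sub_of_hasDeriv_right_of_le ht
    (fun s hs => ((hv s hs.1).mono Icc_subset_Ici_self).continuousWithinAt)
    (fun s hs => (hv s hs.1.le).mono fun r hr => hs.1.le.trans (le_of_lt hr))
    (intervalIntegrable_of_continuousOn_Ici hF ht), add_sub_cancel]

theorem norm_le_exp_mul_of_eq_add_integral [CompleteSpace K] (hF : ContinuousOn F (Ici 0))
    (hv : ∀ t, 0 ≤ t → v t = x₀ + ∫ s in (0 : ℝ)..t, F s)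
    (hFv : ∀ t, 0 ≤ t → ‖F t‖ ≤ M * ‖v t‖) (ht : 0 ≤ t) :
    ‖v t‖ ≤ Real.exp (M * t) * ‖x₀‖ := by
  have hderiv (s : ℝ) (hs : 0 ≤ s) := hasDerivWithinAt_of_eq_add_integral hF hv hs
  have h0 : v 0 = x₀ := by simpa using hv 0 le_rfl
  have hgronwall := norm_le_gronwallBound_of_norm_deriv_right_le (ε := 0) (b := t)
    (fun s hs => ((hderiv s hs.1).mono Icc_subset_Ici_self).continuousWithinAt)
    (fun s hs => (hderiv s hs.1).mono (Ici_subset_Ici.2 hs.1)) (by rw [h0])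
    (fun s hs => by simpa using hFv s hs.1) t ⟨ht, le_rfl⟩
  rwa [gronwallBound_ε0, sub_zero, mul_comm] at hgronwall

end Volterra

section Diagonal

variable {ι K : Type*} [NormedAddCommGroup K] [InnerProductSpace ℂ K]

theorem eq_of_forall_inner_basis_eq (b : HilbertBasis ι ℂ K) {x y : K}
    (h : ∀ n, ⟪b n, x⟫_ℂ = ⟪b n, y⟫_ℂ) : x = y := by
  apply b.repr.injective
  ext n
  rw [b.repr_apply_apply, b.repr_apply_apply, h]

theorem orthonormal_circle_smul {v : ι → K} (hv : Orthonormal ℂ v) (z : ι → Circle) :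
    Orthonormal ℂ fun n => (z n : ℂ) • v n := by
  refine ⟨fun n => by rw [norm_smul, Circle.norm_coe, one_mul, hv.1 n], fun m n hmn => ?_⟩
  change ⟪(z m : ℂ) • v m, (z n : ℂ) • v n⟫_ℂ = 0
  rw [inner_smul_left, inner_smul_right, hv.2 hmn, mul_zero, mul_zero]

theorem inner_intervalIntegral_right [CompleteSpace K] (x : K) {F : ℝ → K}
    (hF : ContinuousOn F (Ici 0)) {t : ℝ} (ht : 0 ≤ t) :
    ⟪x, ∫ s in (0 : ℝ)..t, F s⟫_ℂ = ∫ s in (0 : ℝ)..t, ⟪x, F s⟫_ℂ :=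
  ((innerSL ℂ x).intervalIntegral_comp_comm (intervalIntegrable_of_continuousOn_Ici hF ht)).symm

theorem eq_add_integral_iff_inner_basis [CompleteSpace K] (b : HilbertBasis ι ℂ K) {F v : ℝ → K}
    {x₀ : K} (hF : ContinuousOn F (Ici 0)) :
    (∀ t, 0 ≤ t → v t = x₀ + ∫ s in (0 : ℝ)..t, F s) ↔
      v 0 = x₀ ∧ ∀ n t, 0 ≤ t →
        HasDerivWithinAt (fun s => ⟪b n, v s⟫_ℂ) ⟪b n, F t⟫_ℂ (Ici 0) t := by
  refine ⟨fun h => ⟨by simpa using h 0 le_rfl, fun n t ht =>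
    ((innerSL ℂ (b n)).restrictScalars ℝ).hasFDerivAt.comp_hasDerivWithinAt t
      (hasDerivWithinAt_of_eq_add_integral hF h ht)⟩, fun ⟨h0, hd⟩ t ht => ?_⟩
  refine eq_of_forall_inner_basis_eq b fun n => ?_
  rw [inner_add_right, inner_intervalIntegral_right _ hF ht, ← h0]
  exact eq_add_integral_of_hasDerivWithinAt (by fun_prop) (hd n) ht

variable [CompleteSpace K]

/-- The Hilbert basis `z_n b_n`, for unimodular numbers `z_n`. -/
def circleSmulBasis (b : HilbertBasis ι ℂ K) (z : ι → Circle) : HilbertBasis ι ℂ K :=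
  HilbertBasis.mkOfOrthogonalEqBot (orthonormal_circle_smul b.orthonormal z) <| by
    refine (Submodule.eq_bot_iff _).2 fun x hx => eq_of_forall_inner_basis_eq b fun n => ?_
    have hn := (Submodule.mem_orthogonal _ _).1 hx _ (Submodule.subset_span ⟨n, rfl⟩)
    rw [inner_smul_left, mul_eq_zero, map_eq_zero] at hn
    rw [hn.resolve_left (Circle.coe_ne_zero _), inner_zero_right]

/-- The unitary operator with eigenvectors `b_n` and eigenvalues `z_n`. -/
def diagonalUnitary (b : HilbertBasis ι ℂ K) (z : ι → Circle) : K ≃ₗᵢ[ℂ] K :=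
  b.repr.trans (circleSmulBasis b z).repr.symm

theorem inner_diagonalUnitary (b : HilbertBasis ι ℂ K) (z : ι → Circle) (n : ι) (x : K) :
    ⟪b n, diagonalUnitary b z x⟫_ℂ = z n * ⟪b n, x⟫_ℂ := by
  have h : (circleSmulBasis b z).repr (diagonalUnitary b z x) n = b.repr x n := by
    simp only [diagonalUnitary, LinearIsometryEquiv.trans_apply,
      LinearIsometryEquiv.apply_symm_apply]
  rw [HilbertBasis.repr_apply_apply, b.repr_apply_apply, circleSmulBasis,
    HilbertBasis.coe_mkOfOrthogonalEqBot, inner_smul_left, ← Circle.coe_inv_eq_conj] at h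
  rw [← h, ← mul_assoc, ← Circle.coe_mul, mul_inv_cancel, Circle.coe_one, one_mul]

theorem diagonalUnitary_basis (b : HilbertBasis ι ℂ K) (z : ι → Circle) (n : ι) :
    diagonalUnitary b z (b n) = (z n : ℂ) • b n := by
  classical
  refine eq_of_forall_inner_basis_eq b fun m => ?_
  rw [inner_diagonalUnitary, inner_smul_right, orthonormal_iff_ite.1 b.orthonormal]
  split_ifs with hmn
  · rw [hmn]
  · simp only [mul_zero]

/-- The eigenvalue `μ + iθ`. -/
def eigenvalue (μ θ : ℝ) : ℂ := μ + θ * Complex.I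

/-- The group `e^{-tA₀}`, where `A₀` is the diagonal operator `A₀ b_n = (μ + iθ_n) b_n`. -/
def diagonalGroup (b : HilbertBasis ι ℂ K) (θ : ι → ℝ) (μ t : ℝ) : K →L[ℂ] K :=
  (Real.exp (-(μ * t)) : ℂ) •
    ((diagonalUnitary b fun n => Circle.exp (-(θ n * t))).toContinuousLinearEquiv : K →L[ℂ] K)

variable (b : HilbertBasis ι ℂ K) (θ : ι → ℝ) (μ : ℝ)

theorem diagonalGroup_apply (t : ℝ) (x : K) : diagonalGroup b θ μ t x =
    (Real.exp (-(μ * t)) : ℂ) • diagonalUnitary b (fun n => Circle.exp (-(θ n * t))) x := rfl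

theorem norm_diagonalGroup_apply (t : ℝ) (x : K) :
    ‖diagonalGroup b θ μ t x‖ = Real.exp (-(μ * t)) * ‖x‖ := by
  rw [diagonalGroup_apply, norm_smul, Complex.norm_real, Real.norm_of_nonneg (Real.exp_pos _).le,
    LinearIsometryEquiv.norm_map]

theorem inner_diagonalGroup (n : ι) (t : ℝ) (x : K) :
    ⟪b n, diagonalGroup b θ μ t x⟫_ℂ = Complex.exp (-(eigenvalue μ (θ n) * t)) * ⟪b n, x⟫_ℂ := by
  rw [diagonalGroup_apply, inner_smul_right, inner_diagonalUnitary, ← mul_assoc,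
    Complex.ofReal_exp, Circle.coe_exp, ← Complex.exp_add]
  congr 2
  push_cast [eigenvalue]
  ring

theorem diagonalGroup_zero (x : K) : diagonalGroup b θ μ 0 x = x :=
  eq_of_forall_inner_basis_eq b fun n => by simp [inner_diagonalGroup]

theorem diagonalGroup_diagonalGroup_neg (t : ℝ) (x : K) :
    diagonalGroup b θ μ t (diagonalGroup b θ μ (-t) x) = x :=
  eq_of_forall_inner_basis_eq b fun n => by
    rw [inner_diagonalGroup, inner_diagonalGroup, ← mul_assoc, ← Complex.exp_add]
    simp

theorem diagonalGroup_neg_diagonalGroup (t : ℝ) (x : K) :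
    diagonalGroup b θ μ (-t) (diagonalGroup b θ μ t x) = x := by
  simpa using diagonalGroup_diagonalGroup_neg b θ μ (-t) x

theorem continuous_diagonalUnitary_exp :
    Continuous fun q : ℝ × K => diagonalUnitary b (fun n => Circle.exp (-(θ n * q.1))) q.2 := by
  refine continuous_prod_of_dense_continuous_lipschitzWith' _ 1
    (Submodule.dense_iff_topologicalClosure_eq_top.2 b.dense_span)
    (fun t => (diagonalUnitary b fun n => Circle.exp (-(θ n * t))).lipschitz) fun x hx => ?_
  induction hx using Submodule.span_induction with
  | mem _ h =>
    obtain ⟨n, rfl⟩ := h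
    have hscalar : Continuous fun t => (Circle.exp (-(θ n * t)) : ℂ) := by fun_prop
    simp only [diagonalUnitary_basis]
    exact hscalar.smul continuous_const
  | zero => simpa only [map_zero] using continuous_const
  | add _ _ _ _ hx hy =>
    simp only [map_add]
    exact hx.add hy
  | smul c _ _ hx =>
    simp only [map_smul]
    exact hx.const_smul c

theorem continuous_diagonalGroup : Continuous fun q : ℝ × K => diagonalGroup b θ μ q.1 q.2 := by
  have hscalar : Continuous fun q : ℝ × K => (Real.exp (-(μ * q.1)) : ℂ) := by fun_prop
  exact hscalar.smul (continuous_diagonalUnitary_exp b θ)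

/-- The function `v(t) = e^{tA₀} u(t)` associated with a function `u`, for `A₀` as in
`diagonalGroup`. -/
def interactionPicture (u : ℝ → K) (t : ℝ) : K := diagonalGroup b θ μ (-t) (u t)

/-- The operator `C(t) = -e^{tA₀} B e^{-tA₀}`: if `u' = -(A₀ + B) u`, then `v(t) = e^{tA₀} u(t)`
satisfies `v' = C(t) v`. -/
def interaction (B : K →L[ℂ] K) (t : ℝ) : K →L[ℂ] K :=
  -(diagonalGroup b θ μ (-t) ∘L B ∘L diagonalGroup b θ μ t)

variable (B : K →L[ℂ] K) {u v : ℝ → K}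

theorem interactionPicture_zero (u : ℝ → K) : interactionPicture b θ μ u 0 = u 0 := by
  rw [interactionPicture, neg_zero, diagonalGroup_zero]

theorem interaction_apply (t : ℝ) (x : K) : interaction b θ μ B t x =
    -diagonalGroup b θ μ (-t) (B (diagonalGroup b θ μ t x)) := rfl

theorem continuousOn_interactionPicture (hu : ContinuousOn u (Ici 0)) :
    ContinuousOn (interactionPicture b θ μ u) (Ici 0) :=
  (continuous_diagonalGroup b θ μ).comp_continuousOn (f := fun t => (-t, u t)) (by fun_prop)

theorem continuous_interaction : Continuous fun q : ℝ × K => interaction b θ μ B q.1 q.2 := by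
  have hinner : Continuous fun q : ℝ × K => (-q.1, B (diagonalGroup b θ μ q.1 q.2)) :=
    continuous_fst.neg.prodMk (B.continuous.comp (continuous_diagonalGroup b θ μ))
  exact ((continuous_diagonalGroup b θ μ).comp hinner).neg

theorem continuousOn_interaction_apply (hv : ContinuousOn v (Ici 0)) :
    ContinuousOn (fun t => interaction b θ μ B t (v t)) (Ici 0) :=
  (continuous_interaction b θ μ B).comp_continuousOn (f := fun t => (t, v t)) (by fun_prop)

theorem norm_interaction_le (t : ℝ) : ‖interaction b θ μ B t‖ ≤ ‖B‖ := by
  refine ContinuousLinearMap.opNorm_le_bound _ (norm_nonneg B) fun x => ?_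
  rw [interaction_apply, norm_neg, norm_diagonalGroup_apply]
  calc _ ≤ Real.exp (-(μ * -t)) * (‖B‖ * ‖diagonalGroup b θ μ t x‖) := by
        gcongr
        exact B.le_opNorm _
    _ = ‖B‖ * ‖x‖ := by
        rw [norm_diagonalGroup_apply, mul_left_comm, ← mul_assoc (Real.exp _), ← Real.exp_add]
        simp

theorem inner_interactionPicture (n : ι) (t : ℝ) : ⟪b n, interactionPicture b θ μ u t⟫_ℂ =
    Complex.exp (eigenvalue μ (θ n) * t) * ⟪b n, u t⟫_ℂ := by
  simp [interactionPicture, inner_diagonalGroup]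

theorem inner_interaction_interactionPicture (n : ι) (t : ℝ) :
    ⟪b n, interaction b θ μ B t (interactionPicture b θ μ u t)⟫_ℂ =
      Complex.exp (eigenvalue μ (θ n) * t) * -⟪b n, B (u t)⟫_ℂ := by
  simp [interaction_apply, interactionPicture, inner_diagonalGroup, diagonalGroup_diagonalGroup_neg]

end Diagonal

section Modal

variable {ι K : Type*} [NormedAddCommGroup K] [InnerProductSpace ℂ K]

/-- `u` is a continuous solution of `u' = -(A₀ + B) u`, `u(0) = u₀`, where
`A₀ b_n = (μ + iθ_n) b_n`, in the mild sense: the integrated equation is tested against the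
eigenvectors `b_n`, so that `u(t)` need not lie in the domain of `A₀`. -/
structure IsModalSolution (b : HilbertBasis ι ℂ K) (θ : ι → ℝ) (μ : ℝ) (B : K →L[ℂ] K) (u₀ : K)
    (u : ℝ → K) : Prop where
  continuousOn : ContinuousOn u (Ici 0)
  modal : ∀ n t, 0 ≤ t → ⟪b n, u t⟫_ℂ =
    ⟪b n, u₀⟫_ℂ + ∫ s in (0 : ℝ)..t, -(eigenvalue μ (θ n) * ⟪b n, u s⟫_ℂ + ⟪b n, B (u s)⟫_ℂ)

/-- `f` lies in the domain of `A₀ + B` and `g = (A₀ + B) f`, where `A₀ b_n = (μ + iθ_n) b_n`;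
membership in the domain of `A₀` is encoded by the existence of a vector `g` with the right
coefficients. -/
def InModalGraph (b : HilbertBasis ι ℂ K) (θ : ι → ℝ) (μ : ℝ) (B : K →L[ℂ] K) (f g : K) : Prop :=
  ∀ n, ⟪b n, g⟫_ℂ = eigenvalue μ (θ n) * ⟪b n, f⟫_ℂ + ⟪b n, B f⟫_ℂ

variable {b : HilbertBasis ι ℂ K} {θ : ι → ℝ} {μ : ℝ} {B : K →L[ℂ] K} {u₀ v₀ : K} {u v : ℝ → K}

theorem InModalGraph.sub {f g f' g' : K} (h : InModalGraph b θ μ B f g)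
    (h' : InModalGraph b θ μ B f' g') : InModalGraph b θ μ B (f - f') (g - g') := fun n => by
  rw [inner_sub_right, h n, h' n, map_sub, inner_sub_right, inner_sub_right]
  ring

theorem InModalGraph.inner_eq {f g η ξ : K} (h : InModalGraph b θ μ B f g)
    (hηξ : ∀ n, ⟪b n, ξ⟫_ℂ = -(starRingEnd ℂ) (eigenvalue μ (θ n)) * ⟪b n, η⟫_ℂ) :
    ⟪η, g⟫_ℂ = -⟪ξ, f⟫_ℂ + ⟪η, B f⟫_ℂ := by
  suffices hdiag : ⟪η, g - B f⟫_ℂ = -⟪ξ, f⟫_ℂ by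
    rw [← hdiag, inner_sub_right, sub_add_cancel]
  rw [← b.tsum_inner_mul_inner, ← b.tsum_inner_mul_inner, ← tsum_neg]
  congr 1
  funext n
  rw [inner_sub_right, h n, ← inner_conj_symm ξ, hηξ, map_mul, map_neg, Complex.conj_conj,
    inner_conj_symm]
  ring

theorem hasDerivAt_cexp_mul_ofReal (c : ℂ) (t : ℝ) :
    HasDerivAt (fun r : ℝ => Complex.exp (c * r)) (Complex.exp (c * t) * c) t := by
  have hmul : HasDerivAt (fun r : ℝ => c * (r : ℂ)) c t := by
    simpa using (hasDerivAt_id t).ofReal_comp.const_mul c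
  exact hmul.cexp

theorem hasDerivWithinAt_cexp_mul_iff (c : ℂ) {f : ℝ → ℂ} {f' : ℂ} {s : Set ℝ} {t : ℝ} :
    HasDerivWithinAt (fun r : ℝ => Complex.exp (c * r) * f r) (Complex.exp (c * t) * f') s t ↔
      HasDerivWithinAt f (f' - c * f t) s t := by
  have hcancel (r : ℝ) : Complex.exp (-c * r) * Complex.exp (c * r) = 1 := by
    rw [← Complex.exp_add, neg_mul, neg_add_cancel, Complex.exp_zero]
  refine ⟨fun h => ?_, fun h => ?_⟩
  · convert! (hasDerivAt_cexp_mul_ofReal (-c) t).hasDerivWithinAt.mul h using 1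
    · funext r
      simp only [Pi.mul_apply, ← mul_assoc, hcancel, one_mul]
    · linear_combination (c * f t - f') * hcancel t
  · convert! (hasDerivAt_cexp_mul_ofReal c t).hasDerivWithinAt.mul h using 1
    ring

theorem isModalSolution_iff_hasDerivWithinAt (hu : ContinuousOn u (Ici 0)) :
    IsModalSolution b θ μ B u₀ u ↔ u 0 = u₀ ∧ ∀ n t, 0 ≤ t → HasDerivWithinAt
      (fun s => ⟪b n, u s⟫_ℂ) (-(eigenvalue μ (θ n) * ⟪b n, u t⟫_ℂ + ⟪b n, B (u t)⟫_ℂ))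
      (Ici 0) t := by
  have hcont (n : ι) : ContinuousOn
      (fun s => -(eigenvalue μ (θ n) * ⟪b n, u s⟫_ℂ + ⟪b n, B (u s)⟫_ℂ)) (Ici 0) := by fun_prop
  refine ⟨fun h => ⟨eq_of_forall_inner_basis_eq b fun n => by simpa using h.modal n 0 le_rfl,
    fun n t ht => hasDerivWithinAt_of_eq_add_integral (hcont n) (h.modal n) ht⟩,
    fun ⟨h0, hd⟩ => ⟨hu, fun n t ht => ?_⟩⟩
  rw [← h0]
  exact eq_add_integral_of_hasDerivWithinAt (hcont n) (hd n) ht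

theorem IsModalSolution.sub (hu : IsModalSolution b θ μ B u₀ u)
    (hv : IsModalSolution b θ μ B v₀ v) :
    IsModalSolution b θ μ B (u₀ - v₀) (u - v) := by
  have hcont := hu.continuousOn.sub hv.continuousOn
  rw [isModalSolution_iff_hasDerivWithinAt hu.continuousOn] at hu
  rw [isModalSolution_iff_hasDerivWithinAt hv.continuousOn] at hv
  refine (isModalSolution_iff_hasDerivWithinAt hcont).2
    ⟨by rw [Pi.sub_apply, hu.1, hv.1], fun n t ht => ?_⟩
  simp only [Pi.sub_apply, inner_sub_right, map_sub]
  convert! (hu.2 n t ht).sub (hv.2 n t ht) using 1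
  ring

variable [CompleteSpace K]

/- Passing from `u` to `e^{tA₀} u` removes the unbounded operator `A₀`, leaving a Volterra equation
with bounded coefficients. -/
theorem isModalSolution_iff_interactionPicture (hu : ContinuousOn u (Ici 0)) :
    IsModalSolution b θ μ B u₀ u ↔ ∀ t, 0 ≤ t → interactionPicture b θ μ u t =
      u₀ + ∫ s in (0 : ℝ)..t, interaction b θ μ B s (interactionPicture b θ μ u s) := by
  rw [isModalSolution_iff_hasDerivWithinAt hu, eq_add_integral_iff_inner_basis b
    (continuousOn_interaction_apply b θ μ B (continuousOn_interactionPicture b θ μ hu)),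
    interactionPicture_zero]
  simp only [inner_interactionPicture, inner_interaction_interactionPicture,
    hasDerivWithinAt_cexp_mul_iff, neg_add']
  simp only [sub_eq_neg_add, add_comm]

theorem IsModalSolution.norm_le (h : IsModalSolution b θ μ B u₀ u) {t : ℝ} (ht : 0 ≤ t) :
    ‖u t‖ ≤ Real.exp (-(μ - ‖B‖) * t) * ‖u₀‖ := by
  have hgrowth := norm_le_exp_mul_of_eq_add_integral
    (continuousOn_interaction_apply b θ μ B
      (continuousOn_interactionPicture b θ μ h.continuousOn))
    ((isModalSolution_iff_interactionPicture h.continuousOn).1 h)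
    (fun s _ => (interaction b θ μ B s).le_of_opNorm_le (norm_interaction_le b θ μ B s) _) ht
  calc ‖u t‖ = Real.exp (-(μ * t)) * ‖interactionPicture b θ μ u t‖ := by
        rw [← norm_diagonalGroup_apply b θ, interactionPicture, diagonalGroup_diagonalGroup_neg]
    _ ≤ Real.exp (-(μ * t)) * (Real.exp (‖B‖ * t) * ‖u₀‖) := by gcongr
    _ = Real.exp (-(μ - ‖B‖) * t) * ‖u₀‖ := by
        rw [← mul_assoc, ← Real.exp_add]
        congr 2
        ring

theorem IsModalSolution.eq (hu : IsModalSolution b θ μ B u₀ u) (hv : IsModalSolution b θ μ B u₀ v)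
    {t : ℝ} (ht : 0 ≤ t) : u t = v t := by
  have hnorm := (hu.sub hv).norm_le ht
  rw [sub_self, norm_zero, mul_zero, Pi.sub_apply] at hnorm
  exact sub_eq_zero.1 (norm_le_zero_iff.1 hnorm)

theorem IsModalSolution.integral_inModalGraph (hu : IsModalSolution b θ μ B u₀ u) {t : ℝ}
    (ht : 0 ≤ t) : InModalGraph b θ μ B (∫ s in (0 : ℝ)..t, u s) (u₀ - u t) := fun n => by
  have hcont := hu.continuousOn
  have hcontB : ContinuousOn (fun s => B (u s)) (Ici 0) := by fun_prop
  rw [inner_sub_right, hu.modal n t ht,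
    ← B.intervalIntegral_comp_comm (intervalIntegrable_of_continuousOn_Ici hcont ht),
    inner_intervalIntegral_right _ hcont ht, inner_intervalIntegral_right _ hcontB ht,
    intervalIntegral.integral_neg, intervalIntegral.integral_add
      (intervalIntegrable_of_continuousOn_Ici (by fun_prop) ht)
      (intervalIntegrable_of_continuousOn_Ici (by fun_prop) ht),
    intervalIntegral.integral_const_mul]
  ring

theorem IsModalSolution.inner_eq (hu : IsModalSolution b θ μ B u₀ u) {η ξ : K}
    (hηξ : ∀ n, ⟪b n, ξ⟫_ℂ = -(starRingEnd ℂ) (eigenvalue μ (θ n)) * ⟪b n, η⟫_ℂ) {t : ℝ}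
    (ht : 0 ≤ t) : ⟪η, u t⟫_ℂ = ⟪η, u₀⟫_ℂ + ∫ s in (0 : ℝ)..t, (⟪ξ, u s⟫_ℂ - ⟪η, B (u s)⟫_ℂ) := by
  have hcont := hu.continuousOn
  have hgraph := (hu.integral_inModalGraph ht).inner_eq hηξ
  rw [inner_sub_right, inner_intervalIntegral_right _ hcont ht,
    ← B.intervalIntegral_comp_comm (intervalIntegrable_of_continuousOn_Ici hcont ht),
    inner_intervalIntegral_right _ (by fun_prop) ht] at hgraph
  rw [intervalIntegral.integral_sub (intervalIntegrable_of_continuousOn_Ici (by fun_prop) ht)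
    (intervalIntegrable_of_continuousOn_Ici (by fun_prop) ht)]
  linear_combination -hgraph

theorem IsModalSolution.sub_integral_inModalGraph (hv : IsModalSolution b θ μ B v₀ v)
    (h : InModalGraph b θ μ B u₀ v₀) {t : ℝ} (ht : 0 ≤ t) :
    InModalGraph b θ μ B (u₀ - ∫ s in (0 : ℝ)..t, v s) (v t) := by
  simpa using h.sub (hv.integral_inModalGraph ht)

theorem hasDerivWithinAt_sub_integral (hv : ContinuousOn v (Ici 0)) {t : ℝ} (ht : 0 ≤ t) :
    HasDerivWithinAt (fun t => u₀ - ∫ s in (0 : ℝ)..t, v s) (-v t) (Ici 0) t :=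
  hasDerivWithinAt_of_eq_add_integral (F := fun s => -v s) hv.neg
    (fun t _ => by rw [intervalIntegral.integral_neg, sub_eq_add_neg]) ht

theorem IsModalSolution.sub_integral (hv : IsModalSolution b θ μ B v₀ v)
    (h : InModalGraph b θ μ B u₀ v₀) :
    IsModalSolution b θ μ B u₀ fun t => u₀ - ∫ s in (0 : ℝ)..t, v s := by
  have hderiv (t : ℝ) (ht : 0 ≤ t) := hasDerivWithinAt_sub_integral (u₀ := u₀) hv.continuousOn ht
  refine (isModalSolution_iff_hasDerivWithinAt fun t ht => (hderiv t ht).continuousWithinAt).2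
    ⟨by simp, fun n t ht => ?_⟩
  rw [← hv.sub_integral_inModalGraph h ht n, ← inner_neg_right]
  exact ((innerSL ℂ (b n)).restrictScalars ℝ).hasFDerivAt.comp_hasDerivWithinAt t (hderiv t ht)

variable (b θ μ B)

theorem exists_isModalSolution (u₀ : K) : ∃ u, IsModalSolution b θ μ B u₀ u := by
  obtain ⟨v, hvcont, hv⟩ := exists_eq_add_integral
    (A := fun t => (interaction b θ μ B t).restrictScalars ℝ) (continuous_interaction b θ μ B)
    (fun t => (ContinuousLinearMap.norm_restrictScalars _).trans_le
      (norm_interaction_le b θ μ B t)) u₀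
  have hpicture : interactionPicture b θ μ (fun t => diagonalGroup b θ μ t (v t)) = v :=
    funext fun t => diagonalGroup_neg_diagonalGroup b θ μ t (v t)
  have hcont : Continuous fun t => diagonalGroup b θ μ t (v t) :=
    (continuous_diagonalGroup b θ μ).comp (f := fun t => (t, v t)) (by fun_prop)
  refine ⟨_, (isModalSolution_iff_interactionPicture hcont.continuousOn).2 ?_⟩
  rwa [hpicture]

/-- The solution operator `u₀ ↦ u(t)` of `u' = -(A₀ + B) u`, where `A₀ b_n = (μ + iθ_n) b_n`. -/
def modalFlow (t : ℝ) (u₀ : K) : K := (exists_isModalSolution b θ μ B u₀).choose t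

theorem isModalSolution_modalFlow (u₀ : K) :
    IsModalSolution b θ μ B u₀ fun t => modalFlow b θ μ B t u₀ :=
  (exists_isModalSolution b θ μ B u₀).choose_spec

variable {b θ μ B}

theorem modalFlow_eq_sub_integral (h : InModalGraph b θ μ B u₀ v₀) {t : ℝ} (ht : 0 ≤ t) :
    modalFlow b θ μ B t u₀ = u₀ - ∫ s in (0 : ℝ)..t, modalFlow b θ μ B s v₀ :=
  (isModalSolution_modalFlow b θ μ B u₀).eq
    ((isModalSolution_modalFlow b θ μ B v₀).sub_integral h) ht

theorem InModalGraph.modalFlow (h : InModalGraph b θ μ B u₀ v₀) {t : ℝ} (ht : 0 ≤ t) :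
    InModalGraph b θ μ B (modalFlow b θ μ B t u₀) (modalFlow b θ μ B t v₀) := by
  rw [modalFlow_eq_sub_integral h ht]
  exact (isModalSolution_modalFlow b θ μ B v₀).sub_integral_inModalGraph h ht

theorem InModalGraph.hasDerivWithinAt_modalFlow (h : InModalGraph b θ μ B u₀ v₀) {t : ℝ}
    (ht : 0 ≤ t) : HasDerivWithinAt (fun s => WaterTank.modalFlow b θ μ B s u₀)
      (-WaterTank.modalFlow b θ μ B t v₀) (Ici 0) t :=
  (hasDerivWithinAt_sub_integral (isModalSolution_modalFlow b θ μ B v₀).continuousOn ht).congr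
    (fun _ hs => modalFlow_eq_sub_integral h hs) (modalFlow_eq_sub_integral h ht)

end Modal

/-! ### Integration by parts -/

section IntegrationByParts

variable {E : Type*} [NormedAddCommGroup E] [NormedSpace ℝ E] {a b : ℝ}

theorem absolutelyContinuousOnInterval_integral {d : ℝ → E}
    (hd : IntervalIntegrable d volume a b) :
    AbsolutelyContinuousOnInterval (fun x => ∫ s in a..x, d s) a b := by
  have hnorm := hd.norm.absolutelyContinuousOnInterval_intervalIntegral left_mem_uIcc
  refine (absolutelyContinuousOnInterval_iff _ a b).2 fun ε hε => ?_
  obtain ⟨r, hr, hsum⟩ := (absolutelyContinuousOnInterval_iff _ a b).1 hnorm ε hε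
  refine ⟨r, hr, fun I hI hlt => (Finset.sum_le_sum fun i hi => ?_).trans_lt (hsum I hI hlt)⟩
  have hint : ∀ x ∈ uIcc a b, IntervalIntegrable d volume a x := fun x hx =>
    hd.mono_set (uIcc_subset_uIcc left_mem_uIcc hx)
  obtain ⟨h₁, h₂⟩ := hI.1 i hi
  rw [dist_eq_norm, dist_eq_norm, intervalIntegral.integral_interval_sub_left (hint _ h₁)
    (hint _ h₂), intervalIntegral.integral_interval_sub_left (hint _ h₁).norm (hint _ h₂).norm]
  exact intervalIntegral.norm_integral_le_abs_integral_norm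

theorem integral_eq_sub_of_ae_hasDerivAt [CompleteSpace E] {F f : ℝ → E}
    (hF : AbsolutelyContinuousOnInterval F a b) (hf : IntervalIntegrable f volume a b)
    (hderiv : ∀ᵐ x, x ∈ uIcc a b → HasDerivAt F (f x) x) :
    ∫ x in a..b, f x = F b - F a := by
  obtain ⟨c, hc⟩ := ((absolutelyContinuousOnInterval_integral hf).sub
    hF).const_of_ae_hasDerivAt_zero (by
      filter_upwards [hf.ae_hasDerivAt_integral, hderiv] with x hx hx' hmem
      simpa only [sub_self] using (hx hmem a left_mem_uIcc).sub (hx' hmem))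
  have ha := hc a left_mem_uIcc
  have hb := hc b right_mem_uIcc
  simp only [Pi.sub_apply, intervalIntegral.integral_same, zero_sub] at ha hb
  rw [← ha, sub_eq_iff_eq_add] at hb
  rw [hb]
  abel

theorem integral_deriv_smul_add_smul_deriv {𝕜 : Type*} [RCLike 𝕜] [NormedSpace 𝕜 E]
    [IsScalarTower ℝ 𝕜 E] [CompleteSpace E] {p p' : ℝ → 𝕜} {q d : ℝ → E}
    (hp : ∀ x, HasDerivAt p (p' x) x) (hp' : Continuous p')
    (hd : IntervalIntegrable d volume a b)
    (hq : ∀ x ∈ uIcc a b, q x = q a + ∫ s in a..x, d s) :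
    ∫ x in a..b, (p' x • q x + p x • d x) = p b • q b - p a • q a := by
  let Q : ℝ → E := fun x => q a + ∫ s in a..x, d s
  have hderiv : deriv p = p' := funext fun x => (hp x).deriv
  have hpC1 : ContDiff ℝ 1 p := contDiff_one_iff_deriv.2
    ⟨fun x => (hp x).differentiableAt, by rwa [hderiv]⟩
  have hQ : AbsolutelyContinuousOnInterval Q a b :=
    (contDiff_const.contDiffOn.absolutelyContinuousOnInterval).add
      (absolutelyContinuousOnInterval_integral hd)
  have hint : IntervalIntegrable (fun x => p' x • Q x + p x • d x) volume a b :=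
    (hp'.continuousOn.smul hQ.continuousOn).intervalIntegrable.add
      (hd.continuousOn_smul hpC1.continuous.continuousOn)
  have hparts : ∫ x in a..b, (p' x • Q x + p x • d x) = p b • Q b - p a • Q a :=
    integral_eq_sub_of_ae_hasDerivAt
      (hpC1.contDiffOn.absolutelyContinuousOnInterval.smul hQ) hint (by
        filter_upwards [hd.ae_hasDerivAt_integral] with x hx hmem
        convert! (hp x).smul ((hx hmem a left_mem_uIcc).const_add (q a)) using 1
        exact add_comm _ _)
  have hqQ : ∀ x ∈ uIcc a b, q x = Q x := hq
  rw [hqQ b right_mem_uIcc, hqQ a left_mem_uIcc, ← hparts]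
  exact intervalIntegral.integral_congr fun x hx => by simp only [hqQ x hx]

end IntegrationByParts

/-! ### Multiplication operators and weak derivatives -/

section Operators

variable {L : ℝ}

theorem L2.integrable (f : L2 L) : Integrable (fun x => f x) (volume.restrict (Ioo (0 : ℝ) L)) :=
  (Lp.memLp f).integrable (by norm_num)

theorem exists_bound_Ioo_of_continuousOn {F : Type*} [SeminormedAddCommGroup F] {u : ℝ → F}
    {a b : ℝ} (hu : ContinuousOn u (Icc a b)) :
    ∃ C, ∀ᵐ x ∂volume.restrict (Ioo a b), ‖u x‖ ≤ C := by
  obtain ⟨C, hC⟩ := isCompact_Icc.exists_bound_of_continuousOn hu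
  exact ⟨C, (ae_restrict_mem measurableSet_Ioo).mono fun x hx => hC x (Ioo_subset_Icc_self hx)⟩

theorem aestronglyMeasurable_Ioo_of_continuousOn {F : Type*} [NormedAddCommGroup F] {u : ℝ → F}
    {a b : ℝ} (hu : ContinuousOn u (Icc a b)) :
    AEStronglyMeasurable u (volume.restrict (Ioo a b)) :=
  (hu.aestronglyMeasurable_of_isCompact isCompact_Icc measurableSet_Icc).mono_measure
    (Measure.restrict_mono Ioo_subset_Icc_self le_rfl)

theorem integrable_continuousOn_smul_L2 {φ : ℝ → ℝ} (hφ : ContinuousOn φ (Icc 0 L)) (f : L2 L) :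
    Integrable (fun x => φ x • f x) (volume.restrict (Ioo (0 : ℝ) L)) := by
  obtain ⟨C, hC⟩ := exists_bound_Ioo_of_continuousOn hφ
  exact (L2.integrable f).bdd_smul C (aestronglyMeasurable_Ioo_of_continuousOn hφ) hC

theorem memLp_of_continuousOn {u : ℝ → ℂ²} (hu : ContinuousOn u (Icc 0 L)) :
    MemLp u 2 (volume.restrict (Ioo (0 : ℝ) L)) := by
  obtain ⟨C, hC⟩ := exists_bound_Ioo_of_continuousOn hu
  exact MemLp.of_bound (aestronglyMeasurable_Ioo_of_continuousOn hu) C hC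

theorem memLp_smul_L2 (m : C(ℝ, ℝ)) (f : L2 L) :
    MemLp (fun x => m x • f x) 2 (volume.restrict (Ioo (0 : ℝ) L)) := by
  obtain ⟨C, hC⟩ := exists_bound_Ioo_of_continuousOn (m.continuous.continuousOn (s := Icc 0 L))
  refine (Lp.memLp f).of_le_mul (c := C)
    (m.continuous.aestronglyMeasurable.smul (Lp.aestronglyMeasurable f)) ?_
  filter_upwards [hC] with x hx
  rw [norm_smul]
  exact mul_le_mul_of_nonneg_right hx (norm_nonneg _)

theorem norm_toLp_smul_le {m : C(ℝ, ℝ)} {c : ℝ}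
    (hm : ∀ᵐ x ∂volume.restrict (Ioo (0 : ℝ) L), ‖m x‖ ≤ c) (f : L2 L) :
    ‖(memLp_smul_L2 m f).toLp‖ ≤ c * ‖f‖ := by
  apply Lp.norm_le_mul_norm_of_ae_le_mul
  filter_upwards [(memLp_smul_L2 m f).coeFn_toLp, hm] with x hx hx'
  rw [hx, norm_smul]
  exact mul_le_mul_of_nonneg_right hx' (norm_nonneg _)

variable (L) in
/-- Multiplication by a real continuous function, as an operator on `L²((0,L); ℂ²)`. -/
def mulCLM (m : C(ℝ, ℝ)) : L2 L →L[ℂ] L2 L :=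
  LinearMap.mkContinuousOfExistsBound
    { toFun := fun f => (memLp_smul_L2 m f).toLp
      map_add' := fun f g => by
        rw [← MemLp.toLp_add]
        apply MemLp.toLp_congr
        filter_upwards [Lp.coeFn_add f g] with x hx
        rw [hx, Pi.add_apply, smul_add, Pi.add_apply]
      map_smul' := fun c f => by
        rw [RingHom.id_apply, ← MemLp.toLp_const_smul]
        apply MemLp.toLp_congr
        filter_upwards [Lp.coeFn_smul c f] with x hx
        rw [hx, Pi.smul_apply, smul_comm, Pi.smul_apply] }
    ((exists_bound_Ioo_of_continuousOn m.continuous.continuousOn).imp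
      fun _ hC => norm_toLp_smul_le hC)

theorem coeFn_mulCLM (m : C(ℝ, ℝ)) (f : L2 L) :
    mulCLM L m f =ᵐ[volume.restrict (Ioo (0 : ℝ) L)] fun x => m x • f x :=
  (memLp_smul_L2 m f).coeFn_toLp

theorem norm_mulCLM_le {m : C(ℝ, ℝ)} {c : ℝ} (hc : 0 ≤ c) (hm : ∀ x ∈ Ioo 0 L, |m x| ≤ c) :
    ‖mulCLM L m‖ ≤ c :=
  ContinuousLinearMap.opNorm_le_bound _ hc
    (norm_toLp_smul_le ((ae_restrict_mem measurableSet_Ioo).mono hm))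

variable (L) in
/-- The pointwise action of a constant linear map, as an operator on `L²((0,L); ℂ²)`. -/
def pointwiseCLM (A : ℂ² →L[ℂ] ℂ²) : L2 L →L[ℂ] L2 L :=
  A.compLpL 2 (volume.restrict (Ioo (0 : ℝ) L))

theorem coeFn_pointwiseCLM (A : ℂ² →L[ℂ] ℂ²) (f : L2 L) :
    pointwiseCLM L A f =ᵐ[volume.restrict (Ioo (0 : ℝ) L)] fun x => A (f x) :=
  A.coeFn_compLpL f

theorem ae_eq_zero_of_integral_test {F : ℝ → ℂ²}
    (hF : Integrable F (volume.restrict (Ioo (0 : ℝ) L)))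
    (h : ∀ φ : ℝ → ℝ, ContDiff ℝ ∞ φ → HasCompactSupport φ → tsupport φ ⊆ Ioo 0 L →
      ∫ x in Ioo 0 L, φ x • F x = 0) : F =ᵐ[volume.restrict (Ioo (0 : ℝ) L)] 0 := by
  rw [Filter.EventuallyEq, ae_restrict_iff' measurableSet_Ioo]
  refine isOpen_Ioo.ae_eq_zero_of_integral_contDiff_smul_eq_zero
    (IntegrableOn.locallyIntegrableOn hF) fun φ hsmooth hcompact hsupp => ?_
  rw [← h φ hsmooth hcompact hsupp, setIntegral_eq_integral_of_forall_compl_eq_zero]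
  intro x hx
  rw [image_eq_zero_of_notMem_tsupport fun hmem => hx (hsupp hmem), zero_smul]

theorem HasWeakDeriv.unique {f g g' : L2 L} (h : HasWeakDeriv f g) (h' : HasWeakDeriv f g') :
    g = g' := by
  have hzero := ae_eq_zero_of_integral_test ((L2.integrable g).sub (L2.integrable g'))
    fun φ hsmooth hcompact hsupp => by
      simp only [Pi.sub_apply, smul_sub]
      rw [integral_sub (integrable_smul_L2 hsmooth.continuous hcompact g)
        (integrable_smul_L2 hsmooth.continuous hcompact g'), sub_eq_zero, ← neg_inj,
        ← h φ hsmooth hcompact hsupp, h' φ hsmooth hcompact hsupp]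
  apply Lp.ext
  filter_upwards [hzero] with x hx
  exact sub_eq_zero.1 hx

theorem HasWeakDeriv.sub {f g f' g' : L2 L} (hf : HasWeakDeriv f f') (hg : HasWeakDeriv g g') :
    HasWeakDeriv (f - g) (f' - g') := by
  simpa only [neg_smul, one_smul, sub_eq_add_neg] using hf.add (hg.smul (-1))

theorem HasWeakDeriv.pointwiseCLM {f d : L2 L} (A : ℂ² →L[ℂ] ℂ²) (h : HasWeakDeriv f d) :
    HasWeakDeriv (pointwiseCLM L A f) (pointwiseCLM L A d) := by
  intro φ hφ hc hs
  have integral_comm : ∀ (ψ : ℝ → ℝ), Continuous ψ → HasCompactSupport ψ → ∀ a : L2 L,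
      ∫ x in Ioo 0 L, ψ x • WaterTank.pointwiseCLM L A a x
        = A (∫ x in Ioo 0 L, ψ x • a x) := by
    intro ψ hψ hψc a
    rw [← A.integral_comp_comm (integrable_smul_L2 hψ hψc a)]
    apply integral_congr_ae
    filter_upwards [coeFn_pointwiseCLM A a] with x hx
    rw [hx, ← Complex.coe_smul, ← Complex.coe_smul, map_smul]
  rw [integral_comm _ (hφ.continuous_deriv (by simp)) hc.deriv,
    integral_comm _ hφ.continuous hc, h φ hφ hc hs, map_neg]

theorem HasWeakDeriv.mulCLM {f d : L2 L} {m m' : C(ℝ, ℝ)} (hm : ContDiff ℝ ∞ m)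
    (hm' : ∀ x, deriv m x = m' x) (h : HasWeakDeriv f d) :
    HasWeakDeriv (mulCLM L m f) (mulCLM L m' f + mulCLM L m d) := by
  intro φ hφ hc hs
  have hderiv : ∀ x, deriv (fun x => φ x * m x) x = deriv φ x * m x + φ x * m' x := fun x => by
    rw [← hm', deriv_fun_mul (hφ.differentiable (by simp) x) (hm.differentiable (by simp) x)]
  have integral_mul : ∀ (ψ : ℝ → ℝ) (n : C(ℝ, ℝ)) (a : L2 L),
      ∫ x in Ioo 0 L, ψ x • WaterTank.mulCLM L n a x = ∫ x in Ioo 0 L, (ψ x * n x) • a x := by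
    intro ψ n a
    apply integral_congr_ae
    filter_upwards [coeFn_mulCLM n a] with x hx
    rw [hx, smul_smul]
  have integral_sum : ∫ x in Ioo 0 L,
      φ x • (WaterTank.mulCLM L m' f + WaterTank.mulCLM L m d : L2 L) x
        = (∫ x in Ioo 0 L, φ x • WaterTank.mulCLM L m' f x)
          + ∫ x in Ioo 0 L, φ x • WaterTank.mulCLM L m d x := by
    rw [← integral_add (integrable_smul_L2 hφ.continuous hc _)
      (integrable_smul_L2 hφ.continuous hc _)]
    apply integral_congr_ae
    filter_upwards [Lp.coeFn_add (WaterTank.mulCLM L m' f) (WaterTank.mulCLM L m d)] with x hx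
    rw [hx, Pi.add_apply, smul_add]
  have hweak := h (fun x => φ x * m x) (hφ.mul hm) hc.mul_right (tsupport_mul_subset_left.trans hs)
  simp only [hderiv, add_smul] at hweak
  have hφ₀ : Continuous φ := hφ.continuous
  have hφ₁ : Continuous (deriv φ) := hφ.continuous_deriv (by simp)
  rw [integral_add (integrable_continuousOn_smul_L2 (by fun_prop) f)
    (integrable_continuousOn_smul_L2 (by fun_prop) f)] at hweak
  rw [integral_sum, integral_mul, integral_mul, integral_mul, neg_add, ← hweak]
  abel

end Operators

/-! ### Absolutely continuous representatives -/

section Primitives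

variable {E F : Type*} [NormedAddCommGroup E] [NormedSpace ℝ E] [NormedAddCommGroup F]
  [NormedSpace ℝ F] {L : ℝ}

/-- `u` is a primitive of `d` on `[0,L]`: for `d` integrable this says that `u` is absolutely
continuous on `[0,L]` with almost everywhere derivative `d`. -/
def IsPrimitive (L : ℝ) (u d : ℝ → E) : Prop :=
  ∀ x ∈ Icc 0 L, u x = u 0 + ∫ s in (0 : ℝ)..x, d s

theorem IsPrimitive.continuousOn {u d : ℝ → E} (h : IsPrimitive L u d)
    (hd : IntervalIntegrable d volume 0 L) : ContinuousOn u (Icc 0 L) :=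
  (continuousOn_const.add ((absolutelyContinuousOnInterval_integral hd).continuousOn.mono
    Icc_subset_uIcc)).congr h

theorem IsPrimitive.of_hasDerivAt [CompleteSpace E] {u u' : ℝ → E}
    (hu : ∀ x, HasDerivAt u (u' x) x) (hu' : Continuous u') : IsPrimitive L u u' := fun x _ => by
  rw [intervalIntegral.integral_eq_sub_of_hasDerivAt (fun s _ => hu s)
    (hu'.intervalIntegrable _ _), add_sub_cancel]

theorem IsPrimitive.congr_ae {u d d' : ℝ → E} (h : IsPrimitive L u d)
    (hd : d =ᵐ[volume.restrict (Ioo (0 : ℝ) L)] d') : IsPrimitive L u d' := fun x hx => by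
  rw [h x hx]
  congr 1
  apply intervalIntegral.integral_congr_ae_restrict
  rw [uIoc_of_le hx.1, ← restrict_Ioo_eq_restrict_Ioc]
  exact ae_restrict_of_ae_restrict_of_subset (Ioo_subset_Ioo_right hx.2) hd

theorem IsPrimitive.clm_comp [CompleteSpace E] [CompleteSpace F] {u d : ℝ → E}
    (h : IsPrimitive L u d) (hd : IntervalIntegrable d volume 0 L) (A : E →L[ℝ] F) :
    IsPrimitive L (fun x => A (u x)) fun x => A (d x) := fun x hx => by
  have hdx : IntervalIntegrable d volume 0 x :=
    hd.mono_set (uIcc_subset_uIcc left_mem_uIcc (Icc_subset_uIcc hx))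
  simp only [h x hx, map_add, A.intervalIntegral_comp_comm hdx]

theorem setIntegral_Ioo_eq_intervalIntegral {a b : ℝ} (hab : a ≤ b) (f : ℝ → E) :
    ∫ x in Ioo a b, f x = ∫ x in a..b, f x := by
  rw [intervalIntegral.integral_of_le hab, integral_Ioc_eq_integral_Ioo]

end Primitives

section WeakDerivatives

variable {L : ℝ}

theorem L2.intervalIntegrable (hL : 0 ≤ L) (d : L2 L) :
    IntervalIntegrable (fun x => d x) volume 0 L :=
  (intervalIntegrable_iff_integrableOn_Ioo_of_le hL).2 (L2.integrable d)

theorem IsPrimitive.apply (hL : 0 ≤ L) {u : ℝ → ℂ²} {d : L2 L} (h : IsPrimitive L u d)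
    (i : Fin 2) : IsPrimitive L (fun x => u x i) fun x => d x i :=
  h.clm_comp (L2.intervalIntegrable hL d) ((EuclideanSpace.proj (𝕜 := ℂ) i).restrictScalars ℝ)

theorem IsPrimitive.hasWeakDeriv (hL : 0 ≤ L) {u : ℝ → ℂ²} {f d : L2 L} (h : IsPrimitive L u d)
    (hfu : f =ᵐ[volume.restrict (Ioo (0 : ℝ) L)] u) : HasWeakDeriv f d := by
  intro φ hφ hc hs
  have hφ' : Continuous (deriv φ) := hφ.continuous_deriv (by simp)
  have hzero : ∀ x, x ∉ Ioo 0 L → φ x = 0 := fun x hx =>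
    image_eq_zero_of_notMem_tsupport fun hmem => hx (hs hmem)
  have hparts := integral_deriv_smul_add_smul_deriv
    (fun x => (hφ.differentiable (by simp) x).hasDerivAt) hφ' (L2.intervalIntegrable hL d)
    (by rwa [uIcc_of_le hL])
  rw [hzero L (by simp), hzero 0 (by simp), zero_smul, zero_smul, sub_zero,
    ← setIntegral_Ioo_eq_intervalIntegral hL] at hparts
  rw [← add_eq_zero_iff_eq_neg, ← hparts, ← integral_add
    (integrable_smul_L2 hφ' hc.deriv f) (integrable_smul_L2 hφ.continuous hc d)]
  apply integral_congr_ae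
  filter_upwards [hfu] with x hx
  rw [hx]

theorem exists_subset_Icc_subset_Ioo_of_isCompact {K : Set ℝ} {a b : ℝ} (hK : IsCompact K)
    (hne : K.Nonempty) (hKab : K ⊆ Ioo a b) : ∃ a' b', K ⊆ Icc a' b' ∧ Icc a' b' ⊆ Ioo a b := by
  obtain ⟨a', ha', hmin⟩ := hK.exists_isLeast hne
  obtain ⟨b', hb', hmax⟩ := hK.exists_isGreatest hne
  exact ⟨a', b', fun x hx => ⟨hmin hx, hmax hx⟩, Icc_subset_Ioo (hKab ha').1 (hKab hb').2⟩

theorem exists_hasCompactSupport_deriv_eq {h : ℝ → ℝ} {a b : ℝ} (hh : ContDiff ℝ ∞ h)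
    (hc : HasCompactSupport h) (hs : tsupport h ⊆ Ioo a b) (hint : ∫ x, h x = 0) :
    ∃ ψ : ℝ → ℝ, ContDiff ℝ ∞ ψ ∧ HasCompactSupport ψ ∧ tsupport ψ ⊆ Ioo a b ∧
      deriv ψ = h := by
  rcases (tsupport h).eq_empty_or_nonempty with hempty | hne
  · rw [tsupport_eq_empty_iff.1 hempty]
    exact ⟨0, contDiff_const, .zero, by simp [tsupport], deriv_zero⟩
  obtain ⟨a', b', hsub, hIcc⟩ := exists_subset_Icc_subset_Ioo_of_isCompact hc hne hs
  have hzero : ∀ x, x ∉ Icc a' b' → h x = 0 := fun x hx =>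
    image_eq_zero_of_notMem_tsupport fun hmem => hx (hsub hmem)
  let ψ : ℝ → ℝ := fun x => ∫ s in a..x, h s
  have hderiv : ∀ x, HasDerivAt ψ (h x) x := fun x =>
    (hh.continuous.integral_hasStrictDerivAt a x).hasDerivAt
  have hderiv_eq : deriv ψ = h := funext fun x => (hderiv x).deriv
  have hsupp : Function.support ψ ⊆ Icc a' b' := by
    refine Function.support_subset_iff'.2 fun x hx => ?_
    have haa' : a < a' := (hIcc ⟨le_rfl, (nonempty_Icc.1 (hne.mono hsub))⟩).1
    rcases lt_or_ge x a' with hxa | hxa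
    · refine (intervalIntegral.integral_congr (g := 0) fun s hs => hzero s fun hmem => ?_).trans
        (by simp)
      exact (hs.2.trans_lt (max_lt haa' hxa)).not_ge hmem.1
    · refine (intervalIntegral.integral_eq_integral_of_support_subset ?_).trans hint
      refine fun s hs => ?_
      have hmem : s ∈ Icc a' b' := not_imp_comm.1 (hzero s) hs
      exact ⟨haa'.trans_le hmem.1, hmem.2.trans (not_le.1 fun hxb => hx ⟨hxa, hxb⟩).le⟩
  refine ⟨ψ, ?_, .of_support_subset_isCompact isCompact_Icc hsupp,
    (closure_minimal hsupp isClosed_Icc).trans hIcc, hderiv_eq⟩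
  exact contDiff_infty_iff_deriv.2 ⟨fun x => (hderiv x).differentiableAt, by rwa [hderiv_eq]⟩

theorem exists_test_integral_eq_one {a b : ℝ} (hab : a < b) : ∃ φ : ℝ → ℝ, ContDiff ℝ ∞ φ ∧
    HasCompactSupport φ ∧ tsupport φ ⊆ Ioo a b ∧ ∫ x, φ x = 1 := by
  let bump : ContDiffBump ((a + b) / 2) := ⟨(b - a) / 8, (b - a) / 4, by linarith, by linarith⟩
  refine ⟨bump.normed volume, bump.contDiff_normed, bump.hasCompactSupport_normed, ?_,
    bump.integral_normed⟩
  rw [bump.tsupport_normed_eq, Real.closedBall_eq_Icc]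
  exact Icc_subset_Ioo (by simp only [bump]; linarith) (by simp only [bump]; linarith)

theorem HasWeakDeriv.integral_test_eq {f : L2 L} (h : HasWeakDeriv f 0) {φ φ₀ : ℝ → ℝ}
    (hφ : ContDiff ℝ ∞ φ) (hc : HasCompactSupport φ) (hs : tsupport φ ⊆ Ioo 0 L)
    (hφ₀ : ContDiff ℝ ∞ φ₀) (hc₀ : HasCompactSupport φ₀) (hs₀ : tsupport φ₀ ⊆ Ioo 0 L)
    (hone : ∫ x, φ₀ x = 1) :
    ∫ x in Ioo 0 L, φ x • f x = (∫ x, φ x) • ∫ x in Ioo 0 L, φ₀ x • f x := by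
  let c := ∫ x, φ x
  obtain ⟨ψ, hψ, hψc, hψs, hψd⟩ := exists_hasCompactSupport_deriv_eq
    (h := fun x => φ x - c * φ₀ x) (hφ.sub (contDiff_const.mul hφ₀)) (hc.sub hc₀.mul_left)
    ((tsupport_sub _ _).trans (union_subset hs ((tsupport_mul_subset_right).trans hs₀))) (by
      rw [integral_sub (hφ.continuous.integrable_of_hasCompactSupport hc)
        ((hφ₀.continuous.integrable_of_hasCompactSupport hc₀).const_mul c),
        integral_const_mul, hone, mul_one, sub_self])
  have hweak := h ψ hψ hψc hψs
  have hright : ∫ x in Ioo 0 L, ψ x • (0 : L2 L) x = 0 := by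
    rw [integral_eq_zero_of_ae]
    filter_upwards [Lp.coeFn_zero ℂ² 2 (volume.restrict (Ioo (0 : ℝ) L))] with x hx
    rw [hx, Pi.zero_apply, smul_zero]
  simp only [hψd, sub_smul, mul_smul] at hweak
  have hint₀ : Integrable (fun x => c • φ₀ x • f x) (volume.restrict (Ioo (0 : ℝ) L)) :=
    (integrable_smul_L2 hφ₀.continuous hc₀ f).smul c
  rwa [hright, neg_zero, integral_sub (integrable_smul_L2 hφ.continuous hc f) hint₀,
    integral_smul, sub_eq_zero] at hweak

theorem HasWeakDeriv.exists_const (hL : 0 < L) {f : L2 L} (h : HasWeakDeriv f 0) :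
    ∃ c : ℂ², f =ᵐ[volume.restrict (Ioo (0 : ℝ) L)] fun _ => c := by
  obtain ⟨φ₀, hφ₀, hc₀, hs₀, hone⟩ := exists_test_integral_eq_one hL
  let c : ℂ² := ∫ x in Ioo 0 L, φ₀ x • f x
  have hzero := ae_eq_zero_of_integral_test ((L2.integrable f).sub (integrable_const c))
    fun φ hφ hc hs => by
      have hconst : ∫ x in Ioo 0 L, φ x • c = (∫ y, φ y) • c := by
        rw [integral_smul_const, setIntegral_eq_integral_of_forall_compl_eq_zero]
        exact fun x hx => image_eq_zero_of_notMem_tsupport fun hmem => hx (hs hmem)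
      simp only [Pi.sub_apply, smul_sub]
      rw [integral_sub (integrable_smul_L2 hφ.continuous hc f)
        ((hφ.continuous.integrable_of_hasCompactSupport hc).restrict.smul_const c), hconst,
        h.integral_test_eq hφ hc hs hφ₀ hc₀ hs₀ hone, sub_self]
  refine ⟨c, ?_⟩
  filter_upwards [hzero] with x hx
  exact sub_eq_zero.1 hx

theorem HasWeakDeriv.exists_isPrimitive (hL : 0 < L) {f d : L2 L} (h : HasWeakDeriv f d) :
    ∃ u : ℝ → ℂ², IsPrimitive L u d ∧ f =ᵐ[volume.restrict (Ioo (0 : ℝ) L)] u := by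
  let U : ℂ² → ℝ → ℂ² := fun c x => c + ∫ s in (0 : ℝ)..x, d s
  have hU : ∀ c, IsPrimitive L (U c) d := fun c x _ => by
    simp only [U, intervalIntegral.integral_same, add_zero]
  have hmem := memLp_of_continuousOn ((hU 0).continuousOn (L2.intervalIntegrable hL.le d))
  have hsub := h.sub ((hU 0).hasWeakDeriv hL.le hmem.coeFn_toLp)
  rw [sub_self] at hsub
  obtain ⟨c, hc⟩ := hsub.exists_const hL
  refine ⟨U c, hU c, ?_⟩
  filter_upwards [hc, hmem.coeFn_toLp, Lp.coeFn_sub f hmem.toLp] with x hcx hUx hsubx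
  rw [hsubx, Pi.sub_apply, hUx, sub_eq_iff_eq_add] at hcx
  rw [hcx]
  simp only [U, zero_add]

end WeakDerivatives

/-! ### The Fourier basis -/

section FourierBasis

variable {L : ℝ}

theorem inner_fin_two (u v : ℂ²) :
    inner ℂ u v = (starRingEnd ℂ) (u 0) * v 0 + (starRingEnd ℂ) (u 1) * v 1 := by
  simp only [PiLp.inner_apply, Fin.sum_univ_two, RCLike.inner_apply']

theorem inner_eq_integral (f g : L2 L) :
    inner ℂ f g = ∫ x in Ioo 0 L, inner ℂ (f x) (g x) := rfl

theorem L2.intervalIntegrable_apply (hL : 0 ≤ L) (f : L2 L) (i : Fin 2) :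
    IntervalIntegrable (fun x => f x i) volume 0 L :=
  (intervalIntegrable_iff_integrableOn_Ioo_of_le hL).2 ((L2.integrable f).eval_piLp i)

theorem L2.intervalIntegrable_norm_sq_apply (hL : 0 ≤ L) (f : L2 L) (i : Fin 2) :
    IntervalIntegrable (fun x => ‖f x i‖ ^ 2) volume 0 L :=
  (intervalIntegrable_iff_integrableOn_Ioo_of_le hL).2
    (((Lp.memLp f).eval_piLp i).integrable_norm_pow (by norm_num))

theorem norm_sq_eq_integral (hL : 0 ≤ L) (f : L2 L) :
    ‖f‖ ^ 2 = (∫ x in (0 : ℝ)..L, ‖f x 0‖ ^ 2) + ∫ x in (0 : ℝ)..L, ‖f x 1‖ ^ 2 := by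
  have hpointwise : ∀ x, inner ℂ (f x) (f x) = ((‖f x 0‖ ^ 2 + ‖f x 1‖ ^ 2 : ℝ) : ℂ) := fun x => by
    rw [inner_self_eq_norm_sq_to_K, ← Fin.sum_univ_two (fun i => ‖f x i‖ ^ 2),
      ← EuclideanSpace.norm_sq_eq]
    exact (Complex.ofReal_pow _ _).symm
  rw [← intervalIntegral.integral_add (f.intervalIntegrable_norm_sq_apply hL 0)
    (f.intervalIntegrable_norm_sq_apply hL 1), ← Complex.ofReal_inj, Complex.ofReal_pow]
  rw [← intervalIntegral.integral_ofReal, ← setIntegral_Ioo_eq_intervalIntegral hL]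
  simp_rw [← hpointwise]
  exact (inner_self_eq_norm_sq_to_K f).symm

/-- The frequency `πn/L`. -/
def freq (L : ℝ) (n : ℤ) : ℝ := Real.pi * n / L

theorem freq_sub (L : ℝ) (m n : ℤ) : freq L (m - n) = freq L m - freq L n := by
  simp only [freq]
  push_cast
  ring

/-- The function `(e^{iπnx/L}, e^{-iπnx/L}) / √(2L)`. -/
def modeFun (L : ℝ) (n : ℤ) (x : ℝ) : ℂ² :=
  !₂[(√(2 * L) : ℂ)⁻¹ * Complex.exp (freq L n * x * Complex.I),
    (√(2 * L) : ℂ)⁻¹ * Complex.exp (-(freq L n * x * Complex.I))]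

theorem continuous_modeFun (L : ℝ) (n : ℤ) : Continuous (modeFun L n) :=
  (PiLp.continuous_toLp 2 _).comp (continuous_pi (Fin.forall_fin_two.2
    ⟨by simp only [Matrix.cons_val_zero]; fun_prop, by simp only [Matrix.cons_val_one]; fun_prop⟩))

/-- The class of `modeFun L n` in `L²((0,L); ℂ²)`. -/
def modeVec (L : ℝ) (n : ℤ) : L2 L :=
  (memLp_of_continuousOn (continuous_modeFun L n).continuousOn).toLp

theorem coeFn_modeVec (n : ℤ) :
    modeVec L n =ᵐ[volume.restrict (Ioo (0 : ℝ) L)] modeFun L n :=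
  MemLp.coeFn_toLp _

theorem inner_modeFun (n : ℤ) (x : ℝ) (v : ℂ²) :
    inner ℂ (modeFun L n x) v = (√(2 * L) : ℂ)⁻¹ * (Complex.exp (-(freq L n * x * Complex.I)) * v 0
      + Complex.exp (freq L n * x * Complex.I) * v 1) := by
  rw [inner_fin_two]
  simp only [modeFun, PiLp.toLp_apply, Matrix.cons_val_zero, Matrix.cons_val_one, map_mul,
    map_inv₀, map_neg, Complex.conj_ofReal, Complex.conj_I, ← Complex.exp_conj, mul_neg, neg_neg]
  ring

theorem inner_modeVec (hL : 0 ≤ L) (n : ℤ) (f : L2 L) :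
    inner ℂ (modeVec L n) f = (√(2 * L) : ℂ)⁻¹ * ∫ x in (0 : ℝ)..L,
      (Complex.exp (-(freq L n * x * Complex.I)) * f x 0
        + Complex.exp (freq L n * x * Complex.I) * f x 1) := by
  rw [inner_eq_integral, ← setIntegral_Ioo_eq_intervalIntegral hL, ← integral_const_mul]
  apply integral_congr_ae
  filter_upwards [coeFn_modeVec n] with x hx
  rw [hx, inner_modeFun]

theorem inner_modeFun_modeFun (hL : 0 ≤ L) (m n : ℤ) (x : ℝ) :
    inner ℂ (modeFun L m x) (modeFun L n x)
      = (2 * L : ℂ)⁻¹ * ((2 * Real.cos (freq L (m - n) * x) : ℝ) : ℂ) := by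
  have hsqrt : (√(2 * L) : ℂ)⁻¹ * (√(2 * L) : ℂ)⁻¹ = (2 * L : ℂ)⁻¹ := by
    rw [← mul_inv, ← Complex.ofReal_mul, Real.mul_self_sqrt (by positivity)]
    push_cast
    rfl
  rw [inner_modeFun, ← hsqrt, freq_sub]
  push_cast
  rw [Complex.two_cos, neg_mul, sub_mul, sub_mul, neg_sub, sub_eq_add_neg, sub_eq_add_neg,
    Complex.exp_add, Complex.exp_add]
  simp only [modeFun, PiLp.toLp_apply, Matrix.cons_val_zero, Matrix.cons_val_one]
  ring

theorem integral_cos_freq (hL : 0 < L) (k : ℤ) :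
    ∫ x in (0 : ℝ)..L, Real.cos (freq L k * x) = if k = 0 then L else 0 := by
  split_ifs with hk
  · simp [hk, freq]
  · have hfreq : freq L k ≠ 0 :=
      div_ne_zero (mul_ne_zero Real.pi_ne_zero (Int.cast_ne_zero.2 hk)) hL.ne'
    have hπ : freq L k * L = k * Real.pi := by
      rw [freq, div_mul_cancel₀ _ hL.ne', mul_comm]
    rw [intervalIntegral.integral_comp_mul_left _ hfreq, integral_cos, hπ, Real.sin_int_mul_pi,
      mul_zero, Real.sin_zero, sub_zero, smul_zero]

theorem orthonormal_modeVec (hL : 0 < L) : Orthonormal ℂ (modeVec L) := by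
  rw [orthonormal_iff_ite]
  intro m n
  calc inner ℂ (modeVec L m) (modeVec L n)
      = ∫ x in Ioo 0 L, (2 * L : ℂ)⁻¹ * ((2 * Real.cos (freq L (m - n) * x) : ℝ) : ℂ) := by
        rw [inner_eq_integral]
        apply integral_congr_ae
        filter_upwards [coeFn_modeVec m, coeFn_modeVec n] with x hm hn
        rw [hm, hn, inner_modeFun_modeFun hL.le]
    _ = (2 * L : ℂ)⁻¹ * ((2 * if m - n = 0 then L else 0 : ℝ) : ℂ) := by
        rw [setIntegral_Ioo_eq_intervalIntegral hL.le, intervalIntegral.integral_const_mul,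
          intervalIntegral.integral_ofReal, intervalIntegral.integral_const_mul,
          integral_cos_freq hL]
    _ = if m = n then 1 else 0 := by
        have hL' : (L : ℂ) ≠ 0 := Complex.ofReal_ne_zero.2 hL.ne'
        simp only [sub_eq_zero]
        split_ifs
        · push_cast
          field_simp
        · simp

/-- The function equal to `A` on `(0,L)` and to the reflection of `B` on `(-L,0)`. -/
def glueReflection {V : Type*} (A B : ℝ → V) (y : ℝ) : V := if 0 < y then A y else B (-y)

theorem comp_glueReflection {V W : Type*} (g : V → W) (A B : ℝ → V) (y : ℝ) :
    g (glueReflection A B y) = glueReflection (g ∘ A) (g ∘ B) y :=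
  apply_ite g _ _ _

theorem glueReflection_eqOn_right {V : Type*} {A B : ℝ → V} (hL : 0 ≤ L) :
    EqOn (glueReflection A B) A (uIoc 0 L) :=
  fun _ hy => if_pos (uIoc_of_le hL ▸ hy).1

theorem glueReflection_eqOn_left {V : Type*} {A B : ℝ → V} (hL : 0 ≤ L) :
    EqOn (glueReflection A B) (fun y => B (-y)) (uIoc (-L) 0) :=
  fun _ hy => if_neg (uIoc_of_le (neg_nonpos.2 hL) ▸ hy).2.not_gt

section GlueReflection

variable {V : Type*} [NormedAddCommGroup V] {A B : ℝ → V}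

theorem intervalIntegrable_glueReflection_right (hL : 0 ≤ L)
    (hA : IntervalIntegrable A volume 0 L) :
    IntervalIntegrable (glueReflection A B) volume 0 L :=
  hA.congr (glueReflection_eqOn_right hL).symm

theorem intervalIntegrable_glueReflection_left (hL : 0 ≤ L)
    (hB : IntervalIntegrable B volume 0 L) :
    IntervalIntegrable (glueReflection A B) volume (-L) 0 := by
  refine IntervalIntegrable.congr (glueReflection_eqOn_left hL).symm ?_
  simpa using (IntervalIntegrable.iff_comp_neg (by simp)).1 hB.symm

theorem integral_glueReflection [NormedSpace ℝ V] (hL : 0 ≤ L)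
    (hA : IntervalIntegrable A volume 0 L) (hB : IntervalIntegrable B volume 0 L) :
    ∫ y in (-L)..L, glueReflection A B y
      = (∫ y in (0 : ℝ)..L, A y) + ∫ y in (0 : ℝ)..L, B y := by
  rw [← intervalIntegral.integral_add_adjacent_intervals
      (intervalIntegrable_glueReflection_left hL hB)
      (intervalIntegrable_glueReflection_right hL hA),
    intervalIntegral.integral_congr_ae (ae_of_all _ (glueReflection_eqOn_right hL)),
    intervalIntegral.integral_congr_ae (ae_of_all _ (glueReflection_eqOn_left hL)),
    intervalIntegral.integral_comp_neg, neg_zero, neg_neg, add_comm]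

end GlueReflection

/-- The scalar function on `(-L,L)` obtained by unfolding `f = (f₁, f₂)`: it is `f₁(y)` for `y > 0`
and `f₂(-y)` for `y < 0`. It turns the modes into the exponentials of period `2L`. -/
def unfolding (f : L2 L) : ℝ → ℂ := glueReflection (fun x => f x 0) fun x => f x 1

theorem integral_norm_sq_unfolding (hL : 0 ≤ L) (f : L2 L) :
    ∫ y in (-L)..L, ‖unfolding f y‖ ^ 2 = ‖f‖ ^ 2 := by
  simp_rw [unfolding, comp_glueReflection (fun z : ℂ => ‖z‖ ^ 2)]
  rw [norm_sq_eq_integral hL]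
  exact integral_glueReflection hL (f.intervalIntegrable_norm_sq_apply hL 0)
    (f.intervalIntegrable_norm_sq_apply hL 1)

theorem memLp_unfolding (hL : 0 ≤ L) (f : L2 L) :
    MemLp (unfolding f) 2 (volume.restrict (Ioc (-L) L)) := by
  have hmeas : ∀ i : Fin 2, StronglyMeasurable fun y => f y i := fun i =>
    (EuclideanSpace.proj (𝕜 := ℂ) i).continuous.comp_stronglyMeasurable (Lp.stronglyMeasurable f)
  have hunfold : StronglyMeasurable (unfolding f) :=
    StronglyMeasurable.ite (measurableSet_lt measurable_const measurable_id) (hmeas 0)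
      ((hmeas 1).comp_measurable measurable_neg)
  rw [memLp_two_iff_integrable_sq_norm hunfold.aestronglyMeasurable]
  simp_rw [unfolding, comp_glueReflection (fun z : ℂ => ‖z‖ ^ 2)]
  exact (intervalIntegrable_iff_integrableOn_Ioc_of_le (neg_le_self hL)).1
    ((intervalIntegrable_glueReflection_left hL (f.intervalIntegrable_norm_sq_apply hL 1)).trans
      (intervalIntegrable_glueReflection_right hL (f.intervalIntegrable_norm_sq_apply hL 0)))

theorem fourier_neg_eq_exp_freq (hL : L ≠ 0) (n : ℤ) (y : ℝ) :
    fourier (-n) (y : AddCircle (L - -L)) = Complex.exp (-(freq L n * y * Complex.I)) := by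
  rw [fourier_coe_apply]
  congr 1
  have hL' : (L : ℂ) ≠ 0 := Complex.ofReal_ne_zero.2 hL
  simp only [freq]
  push_cast
  field_simp
  ring

theorem fourierCoeffOn_unfolding (hL : 0 < L) (f : L2 L) (n : ℤ) :
    fourierCoeffOn (neg_lt_self hL) (unfolding f) n
      = (√(2 * L) : ℂ)⁻¹ * inner ℂ (modeVec L n) f := by
  have hA : IntervalIntegrable (fun y => Complex.exp (-(freq L n * y * Complex.I)) * f y 0)
      volume 0 L := (f.intervalIntegrable_apply hL.le 0).continuousOn_mul (by fun_prop)
  have hB : IntervalIntegrable (fun y => Complex.exp (freq L n * y * Complex.I) * f y 1)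
      volume 0 L := (f.intervalIntegrable_apply hL.le 1).continuousOn_mul (by fun_prop)
  have hintegrand : ∀ y : ℝ, fourier (-n) (y : AddCircle (L - -L)) • unfolding f y
      = glueReflection (fun y => Complex.exp (-(freq L n * y * Complex.I)) * f y 0)
        (fun y => Complex.exp (freq L n * y * Complex.I) * f y 1) y := fun y => by
    simp only [fourier_neg_eq_exp_freq hL.ne', unfolding, glueReflection, smul_eq_mul, mul_ite,
      Complex.ofReal_neg, mul_neg, neg_mul]
  have hsqrt : (√(2 * L) : ℂ)⁻¹ * (√(2 * L) : ℂ)⁻¹ = ((1 / (L - -L) : ℝ) : ℂ) := by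
    rw [← mul_inv, ← Complex.ofReal_mul, Real.mul_self_sqrt (by positivity), one_div,
      sub_neg_eq_add, ← two_mul, Complex.ofReal_inv]
  rw [fourierCoeffOn_eq_integral]
  simp_rw [hintegrand]
  rw [integral_glueReflection hL.le hA hB, inner_modeVec hL.le,
    intervalIntegral.integral_add hA hB, ← mul_assoc, hsqrt, Complex.real_smul]

theorem eq_zero_of_inner_modeVec (hL : 0 < L) {f : L2 L}
    (h : ∀ n, inner ℂ (modeVec L n) f = 0) : f = 0 := by
  have hcoeff : ∀ n, fourierCoeffOn (neg_lt_self hL) (unfolding f) n = 0 := fun n => by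
    rw [fourierCoeffOn_unfolding hL, h, mul_zero]
  have hparseval := hasSum_sq_fourierCoeffOn (neg_lt_self hL) (memLp_unfolding hL.le f)
  simp only [hcoeff, norm_zero, ne_eq, OfNat.ofNat_ne_zero, not_false_eq_true, zero_pow,
    integral_norm_sq_unfolding hL.le] at hparseval
  have hzero := (smul_eq_zero.1 (hparseval.unique hasSum_zero)).resolve_left
    (inv_ne_zero (by linarith))
  exact norm_eq_zero.1 (pow_eq_zero_iff two_ne_zero |>.1 hzero)

/-- The Hilbert basis `(e^{iπnx/L}, e^{-iπnx/L}) / √(2L)`, `n ∈ ℤ`, of `L²((0,L); ℂ²)`. -/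
def modeBasis (hL : 0 < L) : HilbertBasis ℤ ℂ (L2 L) :=
  HilbertBasis.mkOfOrthogonalEqBot (orthonormal_modeVec hL) ((Submodule.eq_bot_iff _).2
    fun _ hx => eq_zero_of_inner_modeVec hL fun n =>
      (Submodule.mem_orthogonal _ _).1 hx _ (Submodule.subset_span ⟨n, rfl⟩))

theorem coe_modeBasis (hL : 0 < L) (n : ℤ) : modeBasis hL n = modeVec L n := by
  rw [modeBasis, HilbertBasis.coe_mkOfOrthogonalEqBot]

end FourierBasis

/-! ### The weight -/

section Weight

variable {L : ℝ}

theorem ext_fin_two {u v : ℂ²} (h₀ : u 0 = v 0) (h₁ : u 1 = v 1) : u = v :=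
  PiLp.ext (Fin.forall_fin_two.2 ⟨h₀, h₁⟩)

theorem coeFn_pointwiseCLM_matrix (A : Matrix (Fin 2) (Fin 2) ℂ) (f : L2 L) :
    ∀ᵐ x ∂volume.restrict (Ioo (0 : ℝ) L), ∀ i,
      pointwiseCLM L (Matrix.toEuclideanCLM (𝕜 := ℂ) A) f x i
        = A i 0 * f x 0 + A i 1 * f x 1 := by
  filter_upwards [coeFn_pointwiseCLM (Matrix.toEuclideanCLM (𝕜 := ℂ) A) f] with x hx i
  rw [hx, Matrix.ofLp_toEuclideanCLM, Matrix.mulVec_eq_sum, Finset.sum_apply, Fin.sum_univ_two]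
  simp only [Pi.smul_apply, Matrix.transpose_apply, MulOpposite.smul_eq_mul_unop,
    MulOpposite.unop_op]

variable (L) in
/-- Multiplication by `Λ = diag(1,-1)`. -/
def LambdaCLM : L2 L →L[ℂ] L2 L := pointwiseCLM L (Matrix.toEuclideanCLM (𝕜 := ℂ) !![1, 0; 0, -1])

variable (L) in
/-- Multiplication by `m(x) J`. -/
def couplingCLM (m : C(ℝ, ℝ)) : L2 L →L[ℂ] L2 L :=
  mulCLM L m ∘L pointwiseCLM L (Matrix.toEuclideanCLM (𝕜 := ℂ) !![0, 1 / 3; -(1 / 3), 0])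

variable (L) in
/-- Multiplication by `diag(m₀(x), m₁(x))`. -/
def diagonalCLM (m₀ m₁ : C(ℝ, ℝ)) : L2 L →L[ℂ] L2 L :=
  mulCLM L m₀ ∘L pointwiseCLM L (Matrix.toEuclideanCLM (𝕜 := ℂ) !![1, 0; 0, 0]) +
    mulCLM L m₁ ∘L pointwiseCLM L (Matrix.toEuclideanCLM (𝕜 := ℂ) !![0, 0; 0, 1])

theorem coeFn_LambdaCLM (f : L2 L) : ∀ᵐ x ∂volume.restrict (Ioo (0 : ℝ) L),
    LambdaCLM L f x 0 = f x 0 ∧ LambdaCLM L f x 1 = -f x 1 := by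
  filter_upwards [coeFn_pointwiseCLM_matrix !![1, 0; 0, -1] f] with x hx
  simp [LambdaCLM, hx]

theorem coeFn_couplingCLM (m : C(ℝ, ℝ)) (f : L2 L) : ∀ᵐ x ∂volume.restrict (Ioo (0 : ℝ) L),
    couplingCLM L m f x 0 = m x * (1 / 3 * f x 1) ∧
      couplingCLM L m f x 1 = m x * (-(1 / 3) * f x 0) := by
  filter_upwards [coeFn_pointwiseCLM_matrix !![0, 1 / 3; -(1 / 3), 0] f,
    coeFn_mulCLM m (pointwiseCLM L (Matrix.toEuclideanCLM (𝕜 := ℂ) !![0, 1 / 3; -(1 / 3), 0]) f)]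
    with x hJ hm
  rw [couplingCLM, ContinuousLinearMap.comp_apply, hm, PiLp.smul_apply, PiLp.smul_apply, hJ, hJ]
  simp

theorem coeFn_diagonalCLM (m₀ m₁ : C(ℝ, ℝ)) (f : L2 L) : ∀ᵐ x ∂volume.restrict (Ioo (0 : ℝ) L),
    diagonalCLM L m₀ m₁ f x 0 = m₀ x * f x 0 ∧ diagonalCLM L m₀ m₁ f x 1 = m₁ x * f x 1 := by
  let P (A : Matrix (Fin 2) (Fin 2) ℂ) : L2 L := pointwiseCLM L (Matrix.toEuclideanCLM (𝕜 := ℂ) A) f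
  filter_upwards [coeFn_pointwiseCLM_matrix !![1, 0; 0, 0] f,
    coeFn_pointwiseCLM_matrix !![0, 0; 0, 1] f, coeFn_mulCLM m₀ (P !![1, 0; 0, 0]),
    coeFn_mulCLM m₁ (P !![0, 0; 0, 1]),
    Lp.coeFn_add (mulCLM L m₀ (P !![1, 0; 0, 0])) (mulCLM L m₁ (P !![0, 0; 0, 1]))]
    with x h₀ h₁ hm₀ hm₁ hadd
  rw [diagonalCLM, add_apply, ContinuousLinearMap.comp_apply,
    ContinuousLinearMap.comp_apply, hadd, Pi.add_apply, hm₀, hm₁]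
  simp [P, h₀, h₁]

variable (L) in
/-- The weight `diag(e^{-μx}, -e^{-μ(2L-x)})`, which diagonalizes `Λ∂ₓ` under the boundary
conditions of the target system. -/
def weight (μ : ℝ) : L2 L →L[ℂ] L2 L :=
  diagonalCLM L ⟨fun x => Real.exp (-(μ * x)), by fun_prop⟩
    ⟨fun x => -Real.exp (-(μ * (2 * L - x))), by fun_prop⟩

theorem coeFn_weight (μ : ℝ) (f : L2 L) : ∀ᵐ x ∂volume.restrict (Ioo (0 : ℝ) L),
    weight L μ f x 0 = Complex.exp (-(μ * x)) * f x 0 ∧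
      weight L μ f x 1 = -Complex.exp (-(μ * (2 * L - x))) * f x 1 := by
  filter_upwards [coeFn_diagonalCLM ⟨fun x => Real.exp (-(μ * x)), by fun_prop⟩
    ⟨fun x => -Real.exp (-(μ * (2 * L - x))), by fun_prop⟩ f] with x hx
  rw [weight, hx.1, hx.2]
  simp

theorem weight_neg_weight (μ : ℝ) (f : L2 L) : weight L (-μ) (weight L μ f) = f := by
  apply Lp.ext
  filter_upwards [coeFn_weight μ f, coeFn_weight (-μ) (weight L μ f)] with x hx hx'
  apply ext_fin_two
  · rw [hx'.1, hx.1, ← mul_assoc, ← Complex.exp_add]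
    simp
  · rw [hx'.2, hx.2, ← mul_assoc, neg_mul_neg, ← Complex.exp_add]
    simp

theorem weight_weight_neg (μ : ℝ) (f : L2 L) : weight L μ (weight L (-μ) f) = f := by
  simpa using weight_neg_weight (-μ) f

theorem inner_weight_left (μ : ℝ) (f g : L2 L) :
    inner ℂ (weight L μ f) g = inner ℂ f (weight L μ g) := by
  rw [inner_eq_integral, inner_eq_integral]
  apply integral_congr_ae
  filter_upwards [coeFn_weight μ f, coeFn_weight μ g] with x hf hg
  rw [inner_fin_two, inner_fin_two, hf.1, hf.2, hg.1, hg.2]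
  simp only [map_mul, map_neg, ← Complex.exp_conj, Complex.conj_ofReal, map_sub, map_ofNat]
  ring

theorem inner_couplingCLM_left (m : C(ℝ, ℝ)) (f g : L2 L) :
    inner ℂ (couplingCLM L m f) g = -inner ℂ f (couplingCLM L m g) := by
  rw [inner_eq_integral, inner_eq_integral, ← integral_neg]
  apply integral_congr_ae
  filter_upwards [coeFn_couplingCLM m f, coeFn_couplingCLM m g] with x hf hg
  rw [inner_fin_two, inner_fin_two, hf.1, hf.2, hg.1, hg.2]
  simp only [map_mul, map_neg, Complex.conj_ofReal, map_div₀, map_one, map_ofNat]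
  ring

theorem inner_modeVec_weight (hL : 0 ≤ L) (μ : ℝ) (n : ℤ) (f : L2 L) :
    inner ℂ (modeVec L n) (weight L μ f) = (√(2 * L) : ℂ)⁻¹ *
      ((∫ x in (0 : ℝ)..L, Complex.exp (-eigenvalue μ (freq L n) * x) * f x 0)
        - Complex.exp (-(2 * μ * L)) *
          ∫ x in (0 : ℝ)..L, Complex.exp (eigenvalue μ (freq L n) * x) * f x 1) := by
  rw [inner_modeVec hL, ← intervalIntegral.integral_const_mul (Complex.exp _),
    ← intervalIntegral.integral_sub
      ((f.intervalIntegrable_apply hL 0).continuousOn_mul (by fun_prop))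
      (((f.intervalIntegrable_apply hL 1).continuousOn_mul (by fun_prop)).const_mul _),
    ← setIntegral_Ioo_eq_intervalIntegral hL, ← setIntegral_Ioo_eq_intervalIntegral hL]
  congr 1
  apply integral_congr_ae
  filter_upwards [coeFn_weight μ f] with x hx
  rw [hx.1, hx.2, neg_mul, mul_neg, ← sub_eq_add_neg, ← mul_assoc, ← mul_assoc, ← mul_assoc,
    ← Complex.exp_add, ← Complex.exp_add, ← Complex.exp_add]
  simp only [eigenvalue]
  ring_nf

theorem IsPrimitive.integral_cexp_mul (hL : 0 ≤ L) {u d : ℝ → ℂ} (h : IsPrimitive L u d)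
    (hd : IntervalIntegrable d volume 0 L) (c : ℂ) :
    ∫ x in (0 : ℝ)..L, Complex.exp (c * x) * d x
      = Complex.exp (c * L) * u L - u 0 - c * ∫ x in (0 : ℝ)..L, Complex.exp (c * x) * u x := by
  have hu : ContinuousOn u (uIcc 0 L) := uIcc_of_le hL ▸ h.continuousOn hd
  have hexp : Continuous fun x : ℝ => Complex.exp (c * x) := by fun_prop
  have hparts := integral_deriv_smul_add_smul_deriv (hasDerivAt_cexp_mul_ofReal c)
    (hexp.mul continuous_const) hd (fun x hx => h x (uIcc_of_le hL ▸ hx))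
  have hint : IntervalIntegrable (fun x : ℝ => (Complex.exp (c * x) * c) • u x) volume 0 L :=
    ((hexp.mul continuous_const).continuousOn.smul hu).intervalIntegrable
  rw [intervalIntegral.integral_add hint (hd.continuousOn_smul hexp.continuousOn)] at hparts
  simp only [smul_eq_mul, Complex.ofReal_zero, mul_zero, Complex.exp_zero, one_mul, mul_assoc,
    mul_left_comm _ c, intervalIntegral.integral_const_mul] at hparts
  exact eq_sub_of_add_eq' hparts

theorem exp_neg_eigenvalue_freq_mul (hL : L ≠ 0) (μ : ℝ) (n : ℤ) :
    Complex.exp (-eigenvalue μ (freq L n) * L)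
      = Complex.exp (-(2 * μ * L)) * Complex.exp (eigenvalue μ (freq L n) * L) := by
  rw [← Complex.exp_add, Complex.exp_eq_exp_iff_exists_int]
  refine ⟨-n, ?_⟩
  have hL' : (L : ℂ) ≠ 0 := Complex.ofReal_ne_zero.2 hL
  simp only [eigenvalue, freq]
  push_cast
  field_simp
  ring

/-- The boundary terms of the two integrations by parts cancel: at `x = 0` by the first boundary
condition, at `x = L` by the second one and `e^{iπn} = e^{-iπn}`. -/
theorem inner_modeVec_weight_LambdaCLM (hL : 0 < L) (μ : ℝ) {u : ℝ → ℂ²} {f d : L2 L}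
    (hu : IsPrimitive L u d) (hfu : f =ᵐ[volume.restrict (Ioo (0 : ℝ) L)] u)
    (hbc₀ : u 0 0 = -(Real.exp (-2 * μ * L) : ℂ) * u 0 1) (hbcL : u L 1 = -u L 0) (n : ℤ) :
    inner ℂ (modeVec L n) (weight L μ (LambdaCLM L d))
      = eigenvalue μ (freq L n) * inner ℂ (modeVec L n) (weight L μ f) := by
  have hf (c : ℂ) (i : Fin 2) : ∫ x in (0 : ℝ)..L, Complex.exp (c * x) * f x i
      = ∫ x in (0 : ℝ)..L, Complex.exp (c * x) * u x i := by
    rw [← setIntegral_Ioo_eq_intervalIntegral hL.le, ← setIntegral_Ioo_eq_intervalIntegral hL.le]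
    exact integral_congr_ae (hfu.mono fun x hx => by simp only [hx])
  have hd₀ (c : ℂ) : ∫ x in (0 : ℝ)..L, Complex.exp (c * x) * LambdaCLM L d x 0
      = ∫ x in (0 : ℝ)..L, Complex.exp (c * x) * d x 0 := by
    rw [← setIntegral_Ioo_eq_intervalIntegral hL.le, ← setIntegral_Ioo_eq_intervalIntegral hL.le]
    exact integral_congr_ae ((coeFn_LambdaCLM d).mono fun x hx => by simp only [hx.1])
  have hd₁ (c : ℂ) : ∫ x in (0 : ℝ)..L, Complex.exp (c * x) * LambdaCLM L d x 1
      = -∫ x in (0 : ℝ)..L, Complex.exp (c * x) * d x 1 := by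
    rw [← intervalIntegral.integral_neg, ← setIntegral_Ioo_eq_intervalIntegral hL.le,
      ← setIntegral_Ioo_eq_intervalIntegral hL.le]
    exact integral_congr_ae ((coeFn_LambdaCLM d).mono fun x hx => by simp only [hx.2, mul_neg])
  have hparts (i : Fin 2) :=
    (hu.apply hL.le i).integral_cexp_mul hL.le (d.intervalIntegrable_apply hL.le i)
  have hbc₀' : u 0 0 = -Complex.exp (-(2 * μ * L)) * u 0 1 := by
    rw [hbc₀]
    push_cast
    ring_nf
  rw [inner_modeVec_weight hL.le, inner_modeVec_weight hL.le, hd₀, hd₁, hparts 0, hparts 1, hf, hf,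
    exp_neg_eigenvalue_freq_mul hL.ne', hbcL, hbc₀']
  ring

end Weight

/-! ### The target operator -/

section Target

variable {L μ γ : ℝ} {m : C(ℝ, ℝ)}

theorem LambdaCLM_LambdaCLM (f : L2 L) : LambdaCLM L (LambdaCLM L f) = f := by
  apply Lp.ext
  filter_upwards [coeFn_LambdaCLM f, coeFn_LambdaCLM (LambdaCLM L f)] with x hf hΛf
  apply ext_fin_two
  · rw [hΛf.1, hf.1]
  · rw [hΛf.2, hf.2, neg_neg]

theorem coeFn_LambdaCLM_add_couplingCLM (hm : ∀ x ∈ Ioo 0 L, m x = delta L γ x) {f d : L2 L}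
    {u v : ℝ → ℂ²} (hf : f =ᵐ[volume.restrict (Ioo (0 : ℝ) L)] u)
    (hd : d =ᵐ[volume.restrict (Ioo (0 : ℝ) L)] v) :
    (LambdaCLM L d + couplingCLM L m f : L2 L)
      =ᵐ[volume.restrict (Ioo (0 : ℝ) L)] fun x => diffExpr L γ x (u x) (v x) := by
  filter_upwards [hf, hd, coeFn_LambdaCLM d, coeFn_couplingCLM m f,
    Lp.coeFn_add (LambdaCLM L d) (couplingCLM L m f), ae_restrict_mem measurableSet_Ioo]
    with x hfx hdx hΛ hJ hadd hx
  rw [hadd, Pi.add_apply]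
  apply ext_fin_two
  · rw [PiLp.add_apply, hΛ.1, hJ.1, hfx, hdx, hm x hx]
    rfl
  · rw [PiLp.add_apply, hΛ.2, hJ.2, hfx, hdx, hm x hx]
    rfl

theorem targetOp_iff_exists_eq (hm : ∀ x ∈ Ioo 0 L, m x = delta L γ x) {f g : L2 L} :
    TargetOp L μ γ f g ↔ ∃ d : L2 L,
      HasWeakDeriv f d ∧ BoundaryCond L μ f ∧ g = LambdaCLM L d + couplingCLM L m f := by
  refine exists_congr fun d => and_congr_right fun _ => and_congr_right fun _ => ?_
  have hexpr := coeFn_LambdaCLM_add_couplingCLM hm (ae_eq_refl f) (ae_eq_refl d)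
  exact ⟨fun hg => Lp.ext (hg.trans hexpr.symm), fun hg => hg ▸ hexpr⟩

theorem BoundaryCond.exists_isPrimitive (hL : 0 < L) {f d : L2 L} (hf : BoundaryCond L μ f)
    (hd : HasWeakDeriv f d) : ∃ u : ℝ → ℂ², IsPrimitive L u d ∧
      f =ᵐ[volume.restrict (Ioo (0 : ℝ) L)] u ∧
      u 0 0 = -(Real.exp (-2 * μ * L) : ℂ) * u 0 1 ∧ u L 1 = -u L 0 := by
  obtain ⟨v, hv, hfv, hbc₀, hbcL⟩ := hf
  obtain ⟨u, hu, hfu⟩ := hd.exists_isPrimitive hL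
  have hvu : v =ᵐ[volume.restrict (Icc (0 : ℝ) L)] u := by
    rw [← restrict_Ioo_eq_restrict_Icc]
    exact hfv.symm.trans hfu
  have heq : EqOn v u (Icc 0 L) := Measure.eqOn_Icc_of_ae_eq volume hL.ne hvu hv
    (hu.continuousOn (d.intervalIntegrable hL.le))
  rw [heq (left_mem_Icc.2 hL.le)] at hbc₀
  rw [heq (right_mem_Icc.2 hL.le)] at hbcL
  exact ⟨u, hu, hfu, hbc₀, hbcL⟩

theorem eigenvalue_ne_zero (hμ : μ ≠ 0) (θ : ℝ) : eigenvalue μ θ ≠ 0 := fun h =>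
  hμ (by simpa [eigenvalue] using congrArg Complex.re h)

theorem exists_isPrimitive_boundaryCond (hL : L ≠ 0) (hμ : μ ≠ 0) (d : ℝ → ℂ²) :
    ∃ u : ℝ → ℂ², IsPrimitive L u d ∧
      u 0 0 = -(Real.exp (-2 * μ * L) : ℂ) * u 0 1 ∧ u L 1 = -u L 0 := by
  let r : ℂ := (Real.exp (-2 * μ * L) : ℂ)
  have hr : 1 - r ≠ 0 := by
    rw [sub_ne_zero, ne_comm, Ne, Complex.ofReal_eq_one, Real.exp_eq_one_iff]
    simp [hL, hμ]
  let S : ℂ² := ∫ s in (0 : ℝ)..L, d s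
  let c : ℂ := -(S 0 + S 1) / (1 - r)
  have hc : c * (1 - r) = -(S 0 + S 1) := div_mul_cancel₀ _ hr
  let u₀ : ℂ² := !₂[-r * c, c]
  have hu₀ : u₀ + ∫ s in (0 : ℝ)..0, d s = u₀ := by
    rw [intervalIntegral.integral_same, add_zero]
  refine ⟨fun x => u₀ + ∫ s in (0 : ℝ)..x, d s, fun x _ => by simp only [hu₀], ?_, ?_⟩
  · simp only [hu₀]
    rfl
  · change c + S 1 = -(-r * c + S 0)
    linear_combination hc

/-- The primitive `u` of `Λh` satisfying the boundary conditions has the same weighted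
coefficients as `f`, because no eigenvalue vanishes. -/
theorem hasWeakDeriv_of_inner_modeVec (hL : 0 < L) (hμ : μ ≠ 0) {f h : L2 L}
    (hcoeff : ∀ n, inner ℂ (modeVec L n) (weight L μ h)
      = eigenvalue μ (freq L n) * inner ℂ (modeVec L n) (weight L μ f)) :
    HasWeakDeriv f (LambdaCLM L h) ∧ BoundaryCond L μ f := by
  obtain ⟨u, hu, hbc₀, hbcL⟩ := exists_isPrimitive_boundaryCond hL.ne' hμ (LambdaCLM L h)
  have hcont : ContinuousOn u (Icc 0 L) :=
    hu.continuousOn ((LambdaCLM L h).intervalIntegrable hL.le)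
  have hclass := (memLp_of_continuousOn hcont).coeFn_toLp
  have hweight : weight L μ f = weight L μ (memLp_of_continuousOn hcont).toLp :=
    eq_of_forall_inner_basis_eq (modeBasis hL) fun n => by
      have hn := inner_modeVec_weight_LambdaCLM hL μ hu hclass hbc₀ hbcL n
      rw [LambdaCLM_LambdaCLM, hcoeff] at hn
      rw [coe_modeBasis, mul_left_cancel₀ (eigenvalue_ne_zero hμ _) hn]
  have hf : f = (memLp_of_continuousOn hcont).toLp := by
    rw [← weight_neg_weight μ f, hweight, weight_neg_weight]
  rw [← hf] at hclass
  exact ⟨hu.hasWeakDeriv hL.le hclass, u, hcont, hclass, hbc₀, hbcL⟩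

variable (L μ) in
/-- The coupling `m(x) J` in the weighted coordinates. -/
def weightedCoupling (m : C(ℝ, ℝ)) : L2 L →L[ℂ] L2 L :=
  weight L μ ∘L couplingCLM L m ∘L weight L (-μ)

theorem weightedCoupling_weight (m : C(ℝ, ℝ)) (f : L2 L) :
    weightedCoupling L μ m (weight L μ f) = weight L μ (couplingCLM L m f) := by
  simp only [weightedCoupling, ContinuousLinearMap.comp_apply, weight_neg_weight]

variable (L μ) in
theorem exists_norm_weightedCoupling_le : ∃ M : ℝ, 0 ≤ M ∧ ∀ (m : C(ℝ, ℝ)) (c : ℝ), 0 ≤ c →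
    (∀ x ∈ Ioo 0 L, |m x| ≤ c) → ‖weightedCoupling L μ m‖ ≤ M * c := by
  let J : L2 L →L[ℂ] L2 L :=
    pointwiseCLM L (Matrix.toEuclideanCLM (𝕜 := ℂ) !![0, 1 / 3; -(1 / 3), 0])
  refine ⟨‖weight L μ‖ * ‖J‖ * ‖weight L (-μ)‖, by positivity, fun m c hc h => ?_⟩
  calc ‖weightedCoupling L μ m‖
      ≤ ‖weight L μ‖ * (‖mulCLM L m‖ * ‖J‖ * ‖weight L (-μ)‖) := by
        refine (ContinuousLinearMap.opNorm_comp_le _ _).trans ?_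
        gcongr
        refine (ContinuousLinearMap.opNorm_comp_le _ _).trans ?_
        gcongr
        exact ContinuousLinearMap.opNorm_comp_le _ _
    _ ≤ ‖weight L μ‖ * (c * ‖J‖ * ‖weight L (-μ)‖) := by
        gcongr
        exact norm_mulCLM_le hc h
    _ = ‖weight L μ‖ * ‖J‖ * ‖weight L (-μ)‖ * c := by ring

theorem targetOp_iff_inModalGraph (hL : 0 < L) (hμ : μ ≠ 0)
    (hm : ∀ x ∈ Ioo 0 L, m x = delta L γ x) {f g : L2 L} :
    TargetOp L μ γ f g ↔ InModalGraph (modeBasis hL) (freq L) μ (weightedCoupling L μ m)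
      (weight L μ f) (weight L μ g) := by
  rw [targetOp_iff_exists_eq hm]
  simp only [InModalGraph, coe_modeBasis, weightedCoupling_weight]
  constructor
  · rintro ⟨d, hd, hbc, rfl⟩ n
    obtain ⟨u, hu, hfu, hbc₀, hbcL⟩ := hbc.exists_isPrimitive hL hd
    rw [map_add, inner_add_right, inner_modeVec_weight_LambdaCLM hL μ hu hfu hbc₀ hbcL]
  · intro hgraph
    obtain ⟨hd, hbc⟩ := hasWeakDeriv_of_inner_modeVec hL hμ (f := f) (h := g - couplingCLM L m f)
      fun n => by rw [map_sub, inner_sub_right, hgraph, add_sub_cancel_right]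
    exact ⟨_, hd, hbc, by rw [LambdaCLM_LambdaCLM, sub_add_cancel]⟩

end Target

/-! ### Weak solutions in the weighted Fourier basis -/

section WeakSolutions

variable {L μ γ : ℝ} {m : C(ℝ, ℝ)}

/-- The weak formulation of the target system for a function with values in `L²`. -/
def SolvesWeakly (L μ γ : ℝ) (z₀ : L2 L) (z : ℝ → L2 L) : Prop :=
  ∀ ψ : ℝ → ℂ², ContDiff ℝ 1 ψ →
    ψ 0 0 = -(Real.exp (2 * μ * L) : ℂ) * ψ 0 1 → ψ L 1 = -ψ L 0 →
    ∀ t : ℝ, 0 ≤ t → pairing (z t) ψ = pairing z₀ ψ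
      + ∫ s in (0 : ℝ)..t, pairing (z s) (fun x => diffExpr L γ x (ψ x) (deriv ψ x))

theorem pairing_eq_inner {ψ : ℝ → ℂ²} {g : L2 L}
    (hg : g =ᵐ[volume.restrict (Ioo (0 : ℝ) L)] ψ) (f : L2 L) : pairing f ψ = inner ℂ g f := by
  rw [inner_eq_integral, pairing]
  exact integral_congr_ae (hg.mono fun x hx => by simp only [hx])

theorem pairing_diffExpr_eq_inner (hm : ∀ x ∈ Ioo 0 L, m x = delta L γ x) {ψ ψ' : ℝ → ℂ²}
    {g d : L2 L} (hg : g =ᵐ[volume.restrict (Ioo (0 : ℝ) L)] ψ)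
    (hd : d =ᵐ[volume.restrict (Ioo (0 : ℝ) L)] ψ') (f : L2 L) :
    pairing f (fun x => diffExpr L γ x (ψ x) (ψ' x))
      = inner ℂ (LambdaCLM L d) f - inner ℂ g (couplingCLM L m f) := by
  rw [pairing_eq_inner (coeFn_LambdaCLM_add_couplingCLM hm hg hd), inner_add_left,
    inner_couplingCLM_left, sub_eq_add_neg]

theorem inner_weight_neg_weight (f g : L2 L) :
    inner ℂ (weight L (-μ) g) (weight L μ f) = inner ℂ g f := by
  rw [inner_weight_left, weight_neg_weight]

theorem neg_conj_eigenvalue (μ θ : ℝ) :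
    -(starRingEnd ℂ) (eigenvalue μ θ) = eigenvalue (-μ) θ := by
  simp only [eigenvalue, map_add, map_mul, Complex.conj_ofReal, Complex.conj_I, Complex.ofReal_neg]
  ring

/-- The adjoint boundary conditions are those of the target system with `-μ` in place of `μ`. -/
theorem IsModalSolution.solvesWeakly (hL : 0 < L) (hm : ∀ x ∈ Ioo 0 L, m x = delta L γ x)
    {z₀ : L2 L} {z : ℝ → L2 L} (h : IsModalSolution (modeBasis hL) (freq L) μ
      (weightedCoupling L μ m) (weight L μ z₀) fun t => weight L μ (z t)) :
    SolvesWeakly L μ γ z₀ z := by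
  intro ψ hψ hbc₀ hbcL t ht
  have hψ' : Continuous (deriv ψ) := hψ.continuous_deriv_one
  have hg := (memLp_of_continuousOn (L := L) hψ.continuous.continuousOn).coeFn_toLp
  have hd := (memLp_of_continuousOn (L := L) hψ'.continuousOn).coeFn_toLp
  set g : L2 L := (memLp_of_continuousOn hψ.continuous.continuousOn).toLp
  set d : L2 L := (memLp_of_continuousOn hψ'.continuousOn).toLp
  have hprim : IsPrimitive L ψ d := (IsPrimitive.of_hasDerivAt
    (fun x => (hψ.differentiable_one x).hasDerivAt) hψ').congr_ae hd.symm
  have hadj (n : ℤ) : inner ℂ (modeBasis hL n) (weight L (-μ) (LambdaCLM L d))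
      = -(starRingEnd ℂ) (eigenvalue μ (freq L n)) *
        inner ℂ (modeBasis hL n) (weight L (-μ) g) := by
    rw [coe_modeBasis, neg_conj_eigenvalue]
    exact inner_modeVec_weight_LambdaCLM hL (-μ) hprim hg (by simpa using hbc₀) hbcL n
  have hinner := h.inner_eq hadj ht
  simp only [weightedCoupling_weight, inner_weight_neg_weight] at hinner
  simpa only [pairing_eq_inner hg, pairing_diffExpr_eq_inner hm hg hd] using hinner

/-- The continuous representative of the weighted mode `weight L μ (modeVec L n)`, an eigenfunction
of `Λ∂ₓ` under the adjoint boundary conditions. -/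
def adjointMode (L μ : ℝ) (n : ℤ) (x : ℝ) : ℂ² :=
  !₂[(√(2 * L) : ℂ)⁻¹ * Complex.exp (eigenvalue (-μ) (freq L n) * x),
    -((√(2 * L) : ℂ)⁻¹ * Complex.exp (-(2 * μ * L))) *
      Complex.exp (-eigenvalue (-μ) (freq L n) * x)]

theorem coeFn_weight_modeVec (n : ℤ) :
    weight L μ (modeVec L n) =ᵐ[volume.restrict (Ioo (0 : ℝ) L)] adjointMode L μ n := by
  filter_upwards [coeFn_weight μ (modeVec L n), coeFn_modeVec (L := L) n] with x hw hx
  apply ext_fin_two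
  · rw [hw.1, hx]
    simp only [modeFun, adjointMode, eigenvalue, PiLp.toLp_apply, Matrix.cons_val_zero]
    rw [mul_left_comm, ← Complex.exp_add]
    push_cast
    ring_nf
  · rw [hw.2, hx]
    simp only [modeFun, adjointMode, eigenvalue, PiLp.toLp_apply, Matrix.cons_val_zero,
      Matrix.cons_val_one]
    rw [neg_mul, neg_mul, mul_left_comm, mul_assoc (_⁻¹), ← Complex.exp_add, ← Complex.exp_add]
    push_cast
    ring_nf

theorem hasDerivAt_adjointMode (n : ℤ) (x : ℝ) : HasDerivAt (adjointMode L μ n)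
    !₂[eigenvalue (-μ) (freq L n) * adjointMode L μ n x 0,
      -(eigenvalue (-μ) (freq L n) * adjointMode L μ n x 1)] x := by
  have hexp (a c : ℂ) := (hasDerivAt_cexp_mul_ofReal c x).const_mul a
  have hpi : HasDerivAt (fun y i => adjointMode L μ n y i)
      ![eigenvalue (-μ) (freq L n) * adjointMode L μ n x 0,
        -(eigenvalue (-μ) (freq L n) * adjointMode L μ n x 1)] x := by
    refine hasDerivAt_pi.2 (Fin.forall_fin_two.2 ⟨?_, ?_⟩)
    · convert! hexp (√(2 * L) : ℂ)⁻¹ (eigenvalue (-μ) (freq L n)) using 1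
      simp only [adjointMode, PiLp.toLp_apply, Matrix.cons_val_zero]
      ring
    · convert! hexp (-((√(2 * L) : ℂ)⁻¹ * Complex.exp (-(2 * μ * L))))
        (-eigenvalue (-μ) (freq L n)) using 1
      simp only [adjointMode, PiLp.toLp_apply, Matrix.cons_val_zero, Matrix.cons_val_one]
      ring
  exact (PiLp.continuousLinearEquiv 2 ℝ fun _ : Fin 2 => ℂ).symm.hasFDerivAt.comp_hasDerivAt x hpi

theorem contDiff_adjointMode (n : ℤ) : ContDiff ℝ 1 (adjointMode L μ n) := by
  have hexp (a c : ℂ) : ContDiff ℝ 1 fun x : ℝ => a * Complex.exp (c * x) :=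
    contDiff_const.mul (Complex.contDiff_exp.comp (contDiff_const.mul Complex.ofRealCLM.contDiff))
  exact (contDiff_piLp 2).2 (Fin.forall_fin_two.2 ⟨hexp _ _, hexp _ _⟩)

theorem adjointMode_boundary_zero (n : ℤ) :
    adjointMode L μ n 0 0 = -(Real.exp (2 * μ * L) : ℂ) * adjointMode L μ n 0 1 := by
  have hexp : Complex.exp (2 * μ * L) * Complex.exp (-(2 * μ * L)) = 1 := by
    rw [← Complex.exp_add, add_neg_cancel, Complex.exp_zero]
  simp only [adjointMode, PiLp.toLp_apply, Matrix.cons_val_zero, Matrix.cons_val_one,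
    Complex.ofReal_zero, mul_zero, Complex.exp_zero]
  push_cast
  linear_combination (-(√(2 * L) : ℂ)⁻¹) * hexp

theorem adjointMode_boundary_right (hL : L ≠ 0) (n : ℤ) :
    adjointMode L μ n L 1 = -adjointMode L μ n L 0 := by
  have hexp : Complex.exp (-(2 * μ * L)) * Complex.exp (2 * μ * L) = 1 := by
    rw [← Complex.exp_add, neg_add_cancel, Complex.exp_zero]
  have hreflect := exp_neg_eigenvalue_freq_mul hL (-μ) n
  simp only [Complex.ofReal_neg, mul_neg, neg_mul, neg_neg] at hreflect
  simp only [adjointMode, PiLp.toLp_apply, Matrix.cons_val_zero, Matrix.cons_val_one, neg_mul,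
    hreflect]
  linear_combination
    (-(√(2 * L) : ℂ)⁻¹ * Complex.exp (eigenvalue (-μ) (freq L n) * L)) * hexp

theorem pairing_diffExpr_adjointMode (hm : ∀ x ∈ Ioo 0 L, m x = delta L γ x) (n : ℤ) (f : L2 L) :
    pairing f (fun x => diffExpr L γ x (adjointMode L μ n x) (deriv (adjointMode L μ n) x))
      = -(eigenvalue μ (freq L n) * inner ℂ (modeVec L n) (weight L μ f)
        + inner ℂ (modeVec L n) (weightedCoupling L μ m (weight L μ f))) := by
  let σ : ℂ := eigenvalue (-μ) (freq L n)
  let g : L2 L := σ • weight L μ (modeVec L n)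
  have hd : LambdaCLM L g =ᵐ[volume.restrict (Ioo (0 : ℝ) L)] deriv (adjointMode L μ n) := by
    filter_upwards [coeFn_LambdaCLM g, Lp.coeFn_smul σ (weight L μ (modeVec L n)),
      coeFn_weight_modeVec (L := L) (μ := μ) n] with x hΛ hσ hx
    rw [(hasDerivAt_adjointMode n x).deriv]
    apply ext_fin_two
    · rw [hΛ.1, hσ, Pi.smul_apply, hx]
      rfl
    · rw [hΛ.2, hσ, Pi.smul_apply, hx]
      rfl
  rw [pairing_diffExpr_eq_inner hm (coeFn_weight_modeVec n) hd, LambdaCLM_LambdaCLM,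
    inner_smul_left, inner_weight_left, inner_weight_left, weightedCoupling_weight]
  simp only [σ, ← neg_conj_eigenvalue, map_neg, Complex.conj_conj]
  ring

theorem SolvesWeakly.isModalSolution (hL : 0 < L) (hm : ∀ x ∈ Ioo 0 L, m x = delta L γ x)
    {z₀ : L2 L} {z : ℝ → L2 L} (hz : ContinuousOn z (Ici 0)) (h : SolvesWeakly L μ γ z₀ z) :
    IsModalSolution (modeBasis hL) (freq L) μ (weightedCoupling L μ m) (weight L μ z₀)
      fun t => weight L μ (z t) := by
  refine ⟨(weight L μ).continuous.comp_continuousOn hz, fun n t ht => ?_⟩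
  have hweak := h _ (contDiff_adjointMode n) (adjointMode_boundary_zero n)
    (adjointMode_boundary_right hL.ne' n) t ht
  simpa only [pairing_eq_inner (coeFn_weight_modeVec n), inner_weight_left,
    pairing_diffExpr_adjointMode hm, ← coe_modeBasis hL] using hweak

end WeakSolutions

/-! ### The flow of the target system on `L²` -/

section Flow

variable {L μ γ : ℝ}

/-- The solution operator of the target system on `L²`, for a coupling coefficient `m` extended
continuously to `ℝ`. -/
def targetFlow (hL : 0 < L) (μ : ℝ) (m : C(ℝ, ℝ)) (t : ℝ) (z : L2 L) : L2 L :=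
  weight L (-μ) (modalFlow (modeBasis hL) (freq L) μ (weightedCoupling L μ m) t (weight L μ z))

theorem weight_targetFlow (hL : 0 < L) (m : C(ℝ, ℝ)) (t : ℝ) (z : L2 L) :
    weight L μ (targetFlow hL μ m t z)
      = modalFlow (modeBasis hL) (freq L) μ (weightedCoupling L μ m) t (weight L μ z) :=
  weight_weight_neg μ _

theorem continuousOn_targetFlow (hL : 0 < L) (m : C(ℝ, ℝ)) (z : L2 L) :
    ContinuousOn (fun t => targetFlow hL μ m t z) (Ici 0) :=
  (weight L (-μ)).continuous.comp_continuousOn (isModalSolution_modalFlow _ _ _ _ _).continuousOn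

theorem targetFlow_zero (hL : 0 < L) (m : C(ℝ, ℝ)) (z : L2 L) : targetFlow hL μ m 0 z = z := by
  have hmodal := isModalSolution_modalFlow (modeBasis hL) (freq L) μ (weightedCoupling L μ m)
    (weight L μ z)
  rw [targetFlow, ((isModalSolution_iff_hasDerivWithinAt hmodal.continuousOn).1 hmodal).1,
    weight_neg_weight]

theorem norm_targetFlow_le (hL : 0 < L) (m : C(ℝ, ℝ)) (z : L2 L) {t : ℝ} (ht : 0 ≤ t) :
    ‖targetFlow hL μ m t z‖ ≤ ‖weight L (-μ)‖ * ‖weight L μ‖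
      * Real.exp (-(μ - ‖weightedCoupling L μ m‖) * t) * ‖z‖ :=
  calc ‖targetFlow hL μ m t z‖
      ≤ ‖weight L (-μ)‖ * (Real.exp (-(μ - ‖weightedCoupling L μ m‖) * t)
          * ‖weight L μ z‖) :=
        (weight L (-μ)).le_opNorm_of_le ((isModalSolution_modalFlow _ _ _ _ _).norm_le ht)
    _ ≤ ‖weight L (-μ)‖ * (Real.exp (-(μ - ‖weightedCoupling L μ m‖) * t)
          * (‖weight L μ‖ * ‖z‖)) := by
        gcongr
        exact (weight L μ).le_opNorm z
    _ = _ := by ring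

variable {m : C(ℝ, ℝ)}

theorem solvesWeakly_targetFlow (hL : 0 < L) (hm : ∀ x ∈ Ioo 0 L, m x = delta L γ x) (z : L2 L) :
    SolvesWeakly L μ γ z fun t => targetFlow hL μ m t z := by
  apply IsModalSolution.solvesWeakly hL hm
  simp only [weight_targetFlow]
  exact isModalSolution_modalFlow _ _ _ _ _

theorem SolvesWeakly.eq_targetFlow (hL : 0 < L) (hm : ∀ x ∈ Ioo 0 L, m x = delta L γ x)
    {z₀ : L2 L} {z : ℝ → L2 L} (hz : ContinuousOn z (Ici 0)) (h : SolvesWeakly L μ γ z₀ z)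
    {t : ℝ} (ht : 0 ≤ t) : z t = targetFlow hL μ m t z₀ := by
  rw [targetFlow, ← (h.isModalSolution hL hm hz).eq (isModalSolution_modalFlow _ _ _ _ _) ht,
    weight_neg_weight]

theorem TargetOp.targetFlow (hL : 0 < L) (hμ : μ ≠ 0) (hm : ∀ x ∈ Ioo 0 L, m x = delta L γ x)
    {f g : L2 L} (h : TargetOp L μ γ f g) {t : ℝ} (ht : 0 ≤ t) :
    TargetOp L μ γ (targetFlow hL μ m t f) (targetFlow hL μ m t g) := by
  rw [targetOp_iff_inModalGraph hL hμ hm] at h ⊢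
  rw [weight_targetFlow, weight_targetFlow]
  exact h.modalFlow ht

theorem TargetOp.hasDerivWithinAt_targetFlow (hL : 0 < L) (hμ : μ ≠ 0)
    (hm : ∀ x ∈ Ioo 0 L, m x = delta L γ x) {f g : L2 L} (h : TargetOp L μ γ f g) {t : ℝ}
    (ht : 0 ≤ t) : HasDerivWithinAt (fun s => WaterTank.targetFlow hL μ m s f)
      (-WaterTank.targetFlow hL μ m t g) (Ici 0) t := by
  rw [targetOp_iff_inModalGraph hL hμ hm] at h
  rw [WaterTank.targetFlow, ← map_neg]
  exact ((weight L (-μ)).restrictScalars ℝ).hasFDerivAt.comp_hasDerivWithinAt t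
    (h.hasDerivWithinAt_modalFlow ht)

end Flow

/-! ### Operators on `H^p` -/

section Sobolev

variable {L μ γ : ℝ} {p : ℕ}

/-- The `k`-th weak derivative of an element of `H^p`; for `k = 0` it is the underlying function
`Hp.toL2`. -/
def Hp.weakDerivCLM (L : ℝ) (p : ℕ) (k : Fin (p + 1)) : Hp L p →L[ℂ] L2 L :=
  (PiLp.proj 2 (fun _ : Fin (p + 1) => L2 L) k : _ →L[ℂ] L2 L) ∘L (sobolev L p).subtypeL

theorem Hp.hasWeakDeriv (u : Hp L p) (k : Fin p) :
    HasWeakDeriv (Hp.weakDerivCLM L p k.castSucc u) (Hp.weakDerivCLM L p k.succ u) :=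
  u.2 k

theorem Hp.ext_toL2 {u v : Hp L p} (h : u.toL2 = v.toL2) : u = v := by
  have hderiv (k : Fin (p + 1)) : Hp.weakDerivCLM L p k u = Hp.weakDerivCLM L p k v := by
    induction k using Fin.induction with
    | zero => exact h
    | succ k ih =>
      have hk := u.hasWeakDeriv k
      rw [ih] at hk
      exact hk.unique (v.hasWeakDeriv k)
  apply Subtype.ext
  ext1 k
  exact hderiv k

variable {V : Type*} [NormedAddCommGroup V] [NormedSpace ℂ V]

/-- The operator into `H^p` whose successive weak derivatives are the operators `A k`. -/
def Hp.liftCLM (A : Fin (p + 1) → V →L[ℂ] L2 L)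
    (h : ∀ v (k : Fin p), HasWeakDeriv (A k.castSucc v) (A k.succ v)) : V →L[ℂ] Hp L p :=
  ((PiLp.continuousLinearEquiv 2 ℂ fun _ : Fin (p + 1) => L2 L).symm.toContinuousLinearMap ∘L
    ContinuousLinearMap.pi A).codRestrict (sobolev L p) h

/-- The derivative `H^{p+1} → H^p`. -/
def Hp.derivCLM (L : ℝ) (p : ℕ) : Hp L (p + 1) →L[ℂ] Hp L p :=
  Hp.liftCLM (fun k => Hp.weakDerivCLM L (p + 1) k.succ) fun u k => u.hasWeakDeriv k.succ

/-- The inclusion `H^{p+1} → H^p`. -/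
def Hp.inclusionCLM (L : ℝ) (p : ℕ) : Hp L (p + 1) →L[ℂ] Hp L p :=
  Hp.liftCLM (fun k => Hp.weakDerivCLM L (p + 1) k.castSucc) fun u k => u.hasWeakDeriv k.castSucc

theorem Hp.toL2_inclusionCLM (u : Hp L (p + 1)) : (Hp.inclusionCLM L p u).toL2 = u.toL2 := rfl

theorem Hp.hasWeakDeriv_derivCLM (u : Hp L (p + 1)) :
    HasWeakDeriv u.toL2 (Hp.derivCLM L p u).toL2 :=
  u.hasWeakDeriv 0

/-- The operator into `H^{p+1}` with values `A₀ v` and derivatives `A₁ v ∈ H^p`. -/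
def Hp.consCLM (A₀ : V →L[ℂ] L2 L) (A₁ : V →L[ℂ] Hp L p)
    (h : ∀ v, HasWeakDeriv (A₀ v) (A₁ v).toL2) : V →L[ℂ] Hp L (p + 1) :=
  Hp.liftCLM (Fin.cases A₀ fun k => Hp.weakDerivCLM L p k ∘L A₁) fun v k => by
    cases k using Fin.cases with
    | zero => exact h v
    | succ k => exact (A₁ v).hasWeakDeriv k

/-- The pointwise action on `H^p` of a linear map of `ℂ²`. -/
def Hp.pointwiseCLM (L : ℝ) (p : ℕ) (A : ℂ² →L[ℂ] ℂ²) : Hp L p →L[ℂ] Hp L p :=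
  Hp.liftCLM (fun k => WaterTank.pointwiseCLM L A ∘L Hp.weakDerivCLM L p k)
    fun u k => (u.hasWeakDeriv k).pointwiseCLM A

theorem exists_mulHp (L : ℝ) (p : ℕ) (m : C(ℝ, ℝ)) (hm : ContDiff ℝ ∞ m) :
    ∃ M : Hp L p →L[ℂ] Hp L p, ∀ u, (M u).toL2 = mulCLM L m u.toL2 := by
  induction p generalizing m with
  | zero =>
    exact ⟨Hp.liftCLM (fun _ => mulCLM L m ∘L Hp.weakDerivCLM L 0 0) fun _ k => k.elim0,
      fun _ => rfl⟩
  | succ p ih =>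
    obtain ⟨-, hderiv⟩ := contDiff_infty_iff_deriv.1 hm
    let m' : C(ℝ, ℝ) := ⟨deriv m, hderiv.continuous⟩
    obtain ⟨M', hM'⟩ := ih m' hderiv
    obtain ⟨M, hM⟩ := ih m hm
    have hleibniz (u : Hp L (p + 1)) : HasWeakDeriv (mulCLM L m u.toL2)
        ((M' (Hp.inclusionCLM L p u)).toL2 + (M (Hp.derivCLM L p u)).toL2) := by
      rw [hM', hM]
      exact u.hasWeakDeriv_derivCLM.mulCLM (m' := m') hm fun _ => rfl
    exact ⟨Hp.consCLM (mulCLM L m ∘L Hp.weakDerivCLM L (p + 1) 0)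
      (M' ∘L Hp.inclusionCLM L p + M ∘L Hp.derivCLM L p) hleibniz, fun _ => rfl⟩

theorem exists_couplingHp (L : ℝ) (p : ℕ) (m : C(ℝ, ℝ)) (hm : ContDiff ℝ ∞ m) :
    ∃ M : Hp L p →L[ℂ] Hp L p, ∀ u, (M u).toL2 = couplingCLM L m u.toL2 := by
  obtain ⟨M, hM⟩ := exists_mulHp L p m hm
  exact ⟨M ∘L Hp.pointwiseCLM L p (Matrix.toEuclideanCLM (𝕜 := ℂ) !![0, 1 / 3; -(1 / 3), 0]),
    fun _ => hM _⟩

variable (L p) in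
/-- The action of `Λ` on `H^p`. -/
def Hp.LambdaCLM : Hp L p →L[ℂ] Hp L p :=
  Hp.pointwiseCLM L p (Matrix.toEuclideanCLM (𝕜 := ℂ) !![1, 0; 0, -1])

theorem Hp.toL2_LambdaCLM (u : Hp L p) :
    (Hp.LambdaCLM L p u).toL2 = WaterTank.LambdaCLM L u.toL2 := rfl

/-- The subspace on which the operator `A₁` is the weak derivative of the operator `A₀`. -/
def weakDerivSubmodule (A₀ A₁ : V →L[ℂ] L2 L) : Submodule ℂ V where
  carrier := {v | HasWeakDeriv (A₀ v) (A₁ v)}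
  zero_mem' := by simpa using hasWeakDeriv_zero L
  add_mem' := fun {a b} ha hb => by simpa using HasWeakDeriv.add ha hb
  smul_mem' := fun c v hv => by simpa using HasWeakDeriv.smul c hv

theorem exists_consHp_subtype (A₀ : V →L[ℂ] L2 L) (A₁ : V →L[ℂ] Hp L p) :
    ∃ (K : ℝ) (R : {v // HasWeakDeriv (A₀ v) (A₁ v).toL2} → Hp L (p + 1)), 0 ≤ K ∧
      Continuous R ∧ (∀ v, (R v).toL2 = A₀ v) ∧ ∀ v, ‖R v‖ ≤ K * ‖(v : V)‖ := by
  let W := weakDerivSubmodule A₀ (Hp.weakDerivCLM L p 0 ∘L A₁)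
  let R : W →L[ℂ] Hp L (p + 1) := Hp.consCLM (A₀ ∘L W.subtypeL) (A₁ ∘L W.subtypeL) fun v => v.2
  exact ⟨‖R‖, R, norm_nonneg R, R.continuous, fun _ => rfl, fun v => R.le_opNorm v⟩

theorem exists_targetOpHp {m : C(ℝ, ℝ)} (hms : ContDiff ℝ ∞ m)
    (hm : ∀ x ∈ Ioo 0 L, m x = delta L γ x) : ∃ A : Hp L (p + 1) →L[ℂ] Hp L p,
      ∀ (u : Hp L (p + 1)) (g : L2 L), TargetOp L μ γ u.toL2 g → (A u).toL2 = g := by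
  obtain ⟨M, hM⟩ := exists_couplingHp L p m hms
  refine ⟨Hp.LambdaCLM L p ∘L Hp.derivCLM L p + M ∘L Hp.inclusionCLM L p, fun u g hg => ?_⟩
  obtain ⟨d, hd, -, rfl⟩ := (targetOp_iff_exists_eq hm).1 hg
  change (Hp.LambdaCLM L p (Hp.derivCLM L p u)).toL2 + (M (Hp.inclusionCLM L p u)).toL2 = _
  rw [hM, Hp.toL2_LambdaCLM, Hp.toL2_inclusionCLM, hd.unique u.hasWeakDeriv_derivCLM]

/-- Elliptic regularity: `∂ₓu = Λ(g - δJu)` when `g` is the image of `u` under the target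
operator. -/
theorem exists_regularityLift {m : C(ℝ, ℝ)} (hms : ContDiff ℝ ∞ m)
    (hm : ∀ x ∈ Ioo 0 L, m x = delta L γ x) : ∃ (K : ℝ)
      (R : {v : Hp L p × Hp L p // TargetOp L μ γ v.1.toL2 v.2.toL2} → Hp L (p + 1)),
      0 ≤ K ∧ Continuous R ∧ (∀ v, (R v).toL2 = v.1.1.toL2) ∧ ∀ v, ‖R v‖ ≤ K * ‖v.1‖ := by
  obtain ⟨M, hM⟩ := exists_couplingHp L p m hms
  let fstL : Hp L p × Hp L p →L[ℂ] Hp L p := ContinuousLinearMap.fst ℂ _ _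
  let sndL : Hp L p × Hp L p →L[ℂ] Hp L p := ContinuousLinearMap.snd ℂ _ _
  let u : Hp L p × Hp L p →L[ℂ] L2 L := Hp.weakDerivCLM L p 0 ∘L fstL
  let d : Hp L p × Hp L p →L[ℂ] Hp L p := Hp.LambdaCLM L p ∘L (sndL - M ∘L fstL)
  obtain ⟨K, R, hK, hRcont, hRtoL2, hRnorm⟩ := exists_consHp_subtype u d
  have hweak (v : Hp L p × Hp L p) (hv : TargetOp L μ γ v.1.toL2 v.2.toL2) :
      HasWeakDeriv (u v) (d v).toL2 := by
    obtain ⟨d', hd', -, hg⟩ := (targetOp_iff_exists_eq hm).1 hv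
    change HasWeakDeriv v.1.toL2 (LambdaCLM L (v.2.toL2 - (M v.1).toL2))
    rwa [hM, hg, add_sub_cancel_right, LambdaCLM_LambdaCLM]
  exact ⟨K, fun v => R ⟨v, hweak v v.2⟩, hK,
    hRcont.comp (continuous_subtype_val.subtype_mk _), fun _ => hRtoL2 _, fun _ => hRnorm _⟩

end Sobolev

/-! ### The flow of the target system on `H^p` -/

section SobolevFlow

variable {L μ γ : ℝ} {p : ℕ} {m : C(ℝ, ℝ)} {hL : 0 < L}

/-- `z` is a continuous `H^p`-valued function whose underlying `L²`-valued function is the flow of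
the target system issued from `f`. -/
structure IsFlowLift (hL : 0 < L) (μ : ℝ) (m : C(ℝ, ℝ)) (f : L2 L) (z : ℝ → Hp L p) : Prop where
  continuousOn : ContinuousOn z (Ici 0)
  toL2_eq : ∀ t, 0 ≤ t → (z t).toL2 = targetFlow hL μ m t f

theorem exists_isFlowLift_zero (hL : 0 < L) (μ : ℝ) (m : C(ℝ, ℝ)) :
    ∃ C : ℝ, 0 ≤ C ∧ ∀ z₀ : Hp L 0, ∃ z : ℝ → Hp L 0, IsFlowLift hL μ m z₀.toL2 z ∧
      ∀ t, 0 ≤ t → ‖z t‖ ≤ C * Real.exp (-(μ - ‖weightedCoupling L μ m‖) * t) * ‖z₀‖ := by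
  let E : L2 L →L[ℂ] Hp L 0 :=
    Hp.liftCLM (fun _ => ContinuousLinearMap.id ℂ _) fun _ k => k.elim0
  let T : Hp L 0 →L[ℂ] L2 L := Hp.weakDerivCLM L 0 0
  refine ⟨‖E‖ * (‖weight L (-μ)‖ * ‖weight L μ‖) * ‖T‖, by positivity, fun z₀ =>
    ⟨fun t => E (targetFlow hL μ m t z₀.toL2),
      ⟨E.continuous.comp_continuousOn (continuousOn_targetFlow hL m _), fun _ _ => rfl⟩,
      fun t ht => ?_⟩⟩
  calc ‖E (targetFlow hL μ m t z₀.toL2)‖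
      ≤ ‖E‖ * (‖weight L (-μ)‖ * ‖weight L μ‖
          * Real.exp (-(μ - ‖weightedCoupling L μ m‖) * t) * ‖T z₀‖) :=
        E.le_opNorm_of_le (norm_targetFlow_le hL m _ ht)
    _ ≤ ‖E‖ * (‖weight L (-μ)‖ * ‖weight L μ‖
          * Real.exp (-(μ - ‖weightedCoupling L μ m‖) * t) * (‖T‖ * ‖z₀‖)) := by
        gcongr
        exact T.le_opNorm z₀
    _ = _ := by ring

theorem exists_isFlowLift_succ (hL : 0 < L) (hμ : μ ≠ 0) (hms : ContDiff ℝ ∞ m)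
    (hm : ∀ x ∈ Ioo 0 L, m x = delta L γ x) (p : ℕ) : ∃ K : ℝ, 0 ≤ K ∧
      ∀ (f g : L2 L) (F G : ℝ → Hp L p), TargetOp L μ γ f g → IsFlowLift hL μ m f F →
        IsFlowLift hL μ m g G → ∃ z : ℝ → Hp L (p + 1), IsFlowLift hL μ m f z ∧
          ∀ t, 0 ≤ t → ‖z t‖ ≤ K * max ‖F t‖ ‖G t‖ := by
  obtain ⟨K, R, hK, hRcont, hRtoL2, hRnorm⟩ := exists_regularityLift (μ := μ) (p := p) hms hm
  refine ⟨K, hK, fun f g F G hfg hF hG => ?_⟩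
  have hop (t : Ici (0 : ℝ)) : TargetOp L μ γ (F t).toL2 (G t).toL2 := by
    rw [hF.toL2_eq t t.2, hG.toL2_eq t t.2]
    exact hfg.targetFlow hL hμ hm t.2
  let z : Ici (0 : ℝ) → Hp L (p + 1) := fun t => R ⟨(F t, G t), hop t⟩
  have hzcont : Continuous z :=
    hRcont.comp ((hF.continuousOn.domRestrict.prodMk hG.continuousOn.domRestrict).subtype_mk _)
  refine ⟨IciExtend z, ⟨?_, fun t ht => ?_⟩, fun t ht => ?_⟩
  · rw [continuousOn_iff_continuous_domRestrict]
    exact hzcont.congr fun t => (IciExtend_coe z t).symm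
  · rw [IciExtend_of_mem z ht, hRtoL2, hF.toL2_eq t ht]
  · rw [IciExtend_of_mem z ht]
    exact hRnorm _

theorem Compatible.of_succ {f : L2 L} (h : Compatible L μ γ (p + 1) f) : Compatible L μ γ p f := by
  induction p generalizing f with
  | zero => trivial
  | succ p ih =>
    obtain ⟨g, hg, hc⟩ := h
    exact ⟨g, hg, ih hc⟩

theorem exists_isFlowLift (hL : 0 < L) (hμ : μ ≠ 0) (hms : ContDiff ℝ ∞ m)
    (hm : ∀ x ∈ Ioo 0 L, m x = delta L γ x) (p : ℕ) : ∃ C : ℝ, 0 ≤ C ∧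
      ∀ z₀ : Hp L p, Compatible L μ γ p z₀.toL2 →
        ∃ z : ℝ → Hp L p, IsFlowLift hL μ m z₀.toL2 z ∧
          ∀ t, 0 ≤ t → ‖z t‖ ≤ C * Real.exp (-(μ - ‖weightedCoupling L μ m‖) * t) * ‖z₀‖ := by
  induction p with
  | zero =>
    obtain ⟨C, hC, hz⟩ := exists_isFlowLift_zero hL μ m
    exact ⟨C, hC, fun z₀ _ => hz z₀⟩
  | succ p ih =>
    obtain ⟨C, hC, hflow⟩ := ih
    obtain ⟨K, hK, hlift⟩ := exists_isFlowLift_succ hL hμ hms hm p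
    obtain ⟨A, hA⟩ := exists_targetOpHp (μ := μ) (p := p) hms hm
    let N : ℝ := max ‖Hp.inclusionCLM L p‖ ‖A‖
    refine ⟨K * C * N, by positivity, fun z₀ hz₀ => ?_⟩
    obtain ⟨g, hg, hcg⟩ := id hz₀
    have hAg : (A z₀).toL2 = g := hA z₀ g hg
    obtain ⟨F, hF, hFnorm⟩ := hflow (Hp.inclusionCLM L p z₀) hz₀.of_succ
    obtain ⟨G, hG, hGnorm⟩ := hflow (A z₀) (hAg ▸ hcg)
    obtain ⟨z, hz, hznorm⟩ := hlift _ g F G hg hF (hAg ▸ hG)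
    refine ⟨z, hz, fun t ht => ?_⟩
    let e : ℝ := Real.exp (-(μ - ‖weightedCoupling L μ m‖) * t)
    have hι : ‖Hp.inclusionCLM L p z₀‖ ≤ N * ‖z₀‖ :=
      (Hp.inclusionCLM L p).le_of_opNorm_le (le_max_left _ _) z₀
    have hA' : ‖A z₀‖ ≤ N * ‖z₀‖ := A.le_of_opNorm_le (le_max_right _ _) z₀
    calc ‖z t‖ ≤ K * max ‖F t‖ ‖G t‖ := hznorm t ht
      _ ≤ K * (C * e * (N * ‖z₀‖)) := by
        gcongr
        exact max_le ((hFnorm t ht).trans (by gcongr)) ((hGnorm t ht).trans (by gcongr))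
      _ = K * C * N * e * ‖z₀‖ := by ring

theorem IsFlowLift.isWeakSolution (hm : ∀ x ∈ Ioo 0 L, m x = delta L γ x) {z₀ : Hp L p}
    {z : ℝ → Hp L p} (hz : IsFlowLift hL μ m z₀.toL2 z) : IsWeakSolution L μ γ z₀ z where
  continuousOn := hz.continuousOn
  initial := Hp.ext_toL2 (by rw [hz.toL2_eq 0 le_rfl, targetFlow_zero])
  weak ψ hψ hbc₀ hbcL t ht := by
    rw [hz.toL2_eq t ht, solvesWeakly_targetFlow hL hm z₀.toL2 ψ hψ hbc₀ hbcL t ht]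
    congr 1
    refine intervalIntegral.integral_congr fun s hs => ?_
    rw [uIcc_of_le ht] at hs
    simp only [hz.toL2_eq s hs.1]

theorem IsFlowLift.solvesStrongly (hμ : μ ≠ 0) (hm : ∀ x ∈ Ioo 0 L, m x = delta L γ x)
    {f g : L2 L} (hfg : TargetOp L μ γ f g) {z : ℝ → Hp L p} (hz : IsFlowLift hL μ m f z) :
    SolvesStrongly L μ γ z := fun t ht => by
  refine ⟨targetFlow hL μ m t g, ?_, ?_⟩
  · rw [hz.toL2_eq t ht]
    exact hfg.targetFlow hL hμ hm ht
  · exact (hfg.hasDerivWithinAt_targetFlow hL hμ hm ht).congr hz.toL2_eq (hz.toL2_eq t ht)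

theorem IsWeakSolution.eq_of_isFlowLift (hm : ∀ x ∈ Ioo 0 L, m x = delta L γ x) {z₀ : Hp L p}
    {y z : ℝ → Hp L p} (hy : IsWeakSolution L μ γ z₀ y) (hz : IsFlowLift hL μ m z₀.toL2 z)
    {t : ℝ} (ht : 0 ≤ t) : y t = z t := by
  have hyL2 : ContinuousOn (fun s => (y s).toL2) (Ici 0) :=
    (Hp.weakDerivCLM L p 0).continuous.comp_continuousOn hy.continuousOn
  have hweak : SolvesWeakly L μ γ z₀.toL2 fun s => (y s).toL2 := hy.weak
  apply Hp.ext_toL2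
  rw [hz.toL2_eq t ht, ← hweak.eq_targetFlow hL hm hyL2 ht]

theorem expStable_of_le_sub_norm (hL : 0 < L) (hμ : μ ≠ 0) (hms : ContDiff ℝ ∞ m)
    (hm : ∀ x ∈ Ioo 0 L, m x = delta L γ x) {lam : ℝ}
    (hlam : lam ≤ μ - ‖weightedCoupling L μ m‖) (p : ℕ) : ExpStable L μ γ p lam := by
  obtain ⟨C, hC, hflow⟩ := exists_isFlowLift hL hμ hms hm p
  refine ⟨C + 1, by positivity, fun z₀ hz₀ => ?_⟩
  obtain ⟨z, hz, hznorm⟩ := hflow z₀ hz₀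
  refine ⟨z, hz.isWeakSolution hm, fun hp => ?_,
    fun y hy t ht => hy.eq_of_isFlowLift hm hz ht, fun t ht => ?_⟩
  · obtain ⟨q, rfl⟩ := Nat.exists_eq_add_of_le' hp
    obtain ⟨g, hg, -⟩ := hz₀
    exact hz.solvesStrongly hμ hm hg
  · refine (hznorm t ht).trans ?_
    gcongr
    linarith

end SobolevFlow

/-! ### The coupling coefficient -/

section CouplingCoefficient

variable {L γ : ℝ}

theorem exists_contDiff_eq_inv {c : ℝ} (hc : 0 < c) :
    ∃ ρ : ℝ → ℝ, ContDiff ℝ ∞ ρ ∧ ∀ y, c ≤ y → ρ y = y⁻¹ := by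
  refine ⟨fun y => Real.smoothTransition (2 / c * y - 1) * y⁻¹,
    contDiff_iff_contDiffAt.2 fun y => ?_, fun y hy => ?_⟩
  · rcases lt_or_ge y (c / 2) with hy | hy
    · refine (contDiffAt_const (c := (0 : ℝ))).congr_of_eventuallyEq ?_
      filter_upwards [isOpen_Iio.mem_nhds hy] with x hx
      have hneg : 2 / c * x - 1 ≤ 0 := by
        rw [sub_nonpos, div_mul_eq_mul_div, div_le_one hc]
        linarith [mem_Iio.1 hx]
      rw [Real.smoothTransition.zero_of_nonpos hneg, zero_mul]
    · have hne : y ≠ 0 := (lt_of_lt_of_le (half_pos hc) hy).ne'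
      have haffine : ContDiff ℝ ∞ fun x : ℝ => 2 / c * x - 1 := by fun_prop
      exact (Real.smoothTransition.contDiff.comp haffine).contDiffAt.mul (contDiffAt_inv ℝ hne)
  · have hone : 1 ≤ 2 / c * y - 1 := by
      rw [le_sub_iff_add_le, div_mul_eq_mul_div, le_div_iff₀ hc]
      linarith
    simp only [Real.smoothTransition.one_of_one_le hone, one_mul]

theorem half_le_delta_denominator (hL : 0 < L) (hγ : 0 < γ) (h : γ * L ≤ 1) {x : ℝ}
    (hx : x ≤ L) : 1 / 2 ≤ √(1 + γ * L / 2) - γ * Lgam L γ * x / (2 * L) := by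
  have hhalf : 1 / 2 ≤ √(1 - γ * L / 2) := Real.le_sqrt_of_sq_le (by linarith)
  have hmono : √(1 - γ * L / 2) ≤ √(1 + γ * L / 2) :=
    Real.sqrt_le_sqrt (by linarith [mul_pos hγ hL])
  have hle : (√(1 + γ * L / 2) - √(1 - γ * L / 2)) * (x / L)
      ≤ √(1 + γ * L / 2) - √(1 - γ * L / 2) :=
    mul_le_of_le_one_right (sub_nonneg.2 hmono) ((div_le_one hL).2 hx)
  calc 1 / 2 ≤ √(1 + γ * L / 2) - (√(1 + γ * L / 2) - √(1 - γ * L / 2)) * (x / L) := by linarith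
    _ = √(1 + γ * L / 2) - γ * Lgam L γ * x / (2 * L) := by
      rw [Lgam]
      field_simp

theorem Lgam_nonneg (hL : 0 ≤ L) (hγ : 0 ≤ γ) : 0 ≤ Lgam L γ := by
  have hγL : 0 ≤ γ * L := mul_nonneg hγ hL
  exact mul_nonneg (by positivity) (sub_nonneg.2 (Real.sqrt_le_sqrt (by linarith)))

theorem sqrt_one_add_sub_sqrt_one_sub_le {s : ℝ} (hs : 0 ≤ s) (hs1 : s ≤ 1) :
    √(1 + s) - √(1 - s) ≤ 2 * s := by
  have hplus : 1 ≤ √(1 + s) := Real.one_le_sqrt.2 (by linarith)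
  have hminus : 0 ≤ √(1 - s) := Real.sqrt_nonneg _
  have hmono : √(1 - s) ≤ √(1 + s) := Real.sqrt_le_sqrt (by linarith)
  calc √(1 + s) - √(1 - s) ≤ (√(1 + s) - √(1 - s)) * (√(1 + s) + √(1 - s)) :=
        le_mul_of_one_le_right (sub_nonneg.2 hmono) (by linarith)
    _ = √(1 + s) ^ 2 - √(1 - s) ^ 2 := by ring
    _ = 2 * s := by
      rw [Real.sq_sqrt (by linarith), Real.sq_sqrt (by linarith)]
      ring

theorem Lgam_le (hL : 0 ≤ L) (hγ : 0 < γ) (h : γ * L ≤ 1) : Lgam L γ ≤ 2 * L :=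
  calc Lgam L γ ≤ 2 / γ * (2 * (γ * L / 2)) := by
        have hγL : 0 ≤ γ * L := mul_nonneg hγ.le hL
        exact mul_le_mul_of_nonneg_left
          (sqrt_one_add_sub_sqrt_one_sub_le (by linarith) (by linarith)) (by positivity)
    _ = 2 * L := by field_simp

theorem abs_delta_le (hL : 0 < L) (hγ : 0 < γ) (h : γ * L ≤ 1) {x : ℝ} (hx : x ≤ L) :
    |delta L γ x| ≤ 3 * γ := by
  have hden := half_le_delta_denominator hL hγ h hx
  have hnum := Lgam_nonneg hL.le hγ.le
  have hfactor : 3 * Lgam L γ / (4 * L) ≤ 3 / 2 := by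
    rw [div_le_iff₀ (by positivity)]
    linarith [Lgam_le hL.le hγ h]
  have hquot : γ / (√(1 + γ * L / 2) - γ * Lgam L γ * x / (2 * L)) ≤ γ / (1 / 2) := by gcongr
  have hquot₀ : 0 ≤ γ / (√(1 + γ * L / 2) - γ * Lgam L γ * x / (2 * L)) :=
    div_nonneg hγ.le (by linarith)
  rw [delta, abs_mul, abs_neg, abs_of_nonneg (by positivity), abs_of_nonneg hquot₀]
  calc _ ≤ 3 / 2 * (γ / (1 / 2)) := mul_le_mul hfactor hquot hquot₀ (by norm_num)
    _ = 3 * γ := by ring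

theorem exists_contDiff_eq_delta (hL : 0 < L) (hγ : 0 < γ) (h : γ * L ≤ 1) :
    ∃ m : C(ℝ, ℝ), ContDiff ℝ ∞ m ∧ ∀ x ≤ L, m x = delta L γ x := by
  obtain ⟨ρ, hρ, hρinv⟩ := exists_contDiff_eq_inv one_half_pos
  have hsmooth : ContDiff ℝ ∞ fun x => -(3 * Lgam L γ / (4 * L))
      * (γ * ρ (√(1 + γ * L / 2) - γ * Lgam L γ * x / (2 * L))) := by
    fun_prop
  refine ⟨⟨_, hsmooth.continuous⟩, hsmooth, fun x hx => ?_⟩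
  rw [ContinuousMap.coe_mk, hρinv _ (half_le_delta_denominator hL hγ h hx), delta, div_eq_mul_inv γ]

end CouplingCoefficient

theorem exists_forall_expStable {L μ : ℝ} (hL : 0 < L) (hμ : μ ≠ 0) : ∃ M : ℝ, 0 ≤ M ∧
    ∀ γ lam : ℝ, 0 < γ → γ * L ≤ 1 → M * γ ≤ μ - lam → ∀ p, ExpStable L μ γ p lam := by
  obtain ⟨M, hM, hcoupling⟩ := exists_norm_weightedCoupling_le L μ
  refine ⟨M * 3, by positivity, fun γ lam hγ hγL hlam p => ?_⟩
  obtain ⟨m, hms, hm⟩ := exists_contDiff_eq_delta hL hγ hγL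
  have hnorm : ‖weightedCoupling L μ m‖ ≤ M * (3 * γ) :=
    hcoupling m _ (by positivity) fun x hx => by
      rw [hm x hx.2.le]
      exact abs_delta_le hL hγ hγL hx.2.le
  exact expStable_of_le_sub_norm hL hμ hms (fun x hx => hm x hx.2.le) (by linarith) p

end

end WaterTank

theorem mainTheorem6 (L μ : ℝ) (hL : 0 < L) (hμ : 0 < μ) :
    ∃ γs : ℝ → ℝ, ContinuousOn γs (Set.Ioo 0 μ) ∧ StrictAntiOn γs (Set.Ioo 0 μ) ∧
      ∀ lam₀ ∈ Set.Ioo 0 μ, 0 < γs lam₀ ∧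
        ∀ γ ∈ Set.Ioo 0 (γs lam₀), ∀ lam ∈ Set.Icc 0 lam₀, ∀ p : ℕ,
          WaterTank.ExpStable L μ γ p lam := by
  obtain ⟨M, hM, hstable⟩ := WaterTank.exists_forall_expStable hL hμ.ne'
  have hc : 0 < M + μ * L := by positivity
  refine ⟨fun r => (μ - r) / (M + μ * L), by fun_prop,
    fun a _ b _ hab => div_lt_div_of_pos_right (sub_lt_sub_left hab μ) hc,
    fun lam₀ h₀ => ⟨div_pos (sub_pos.2 h₀.2) hc, fun γ hγ lam hlam p => ?_⟩⟩
  have hsum : γ * M + γ * (μ * L) < μ - lam₀ := by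
    rw [← mul_add]
    exact (lt_div_iff₀ hc).1 hγ.2
  have hγM : 0 ≤ γ * M := mul_nonneg hγ.1.le hM
  have hγμL : 0 ≤ γ * (μ * L) := mul_nonneg hγ.1.le (by positivity)
  have hγL : γ * L ≤ 1 := le_of_mul_le_mul_left (by linarith [h₀.1]) hμ
  exact hstable γ lam hγ.1 hγL (by linarith [hlam.2]) p
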